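/- Let $n\ge 1$, let $\lambda=(\lambda_1\ge\lambda_2\ge\dots\ge\lambda_{2n}\ge 0)$ be a partition with $l(\lambda)\le 2n$, written with exactly $2n$ parts (some possibly zero), and let $t,\alpha\in\mathbb{C}$ with $|t|<1$. For $i\ge 0$ let $m_i(\lambda)$ be the number of $j\in\{1,\dots,2n\}$ with $\lambda_j=i$. Put $\phi_r(t)=\prod_{j=1}^{r}(1-t^j)$, $[m]!=\prod_{j=1}^m\frac{1-t^j}{1-t}$, $v_\lambda(t)=\prod_{i\ge 0}[m_i(\lambda)]!$, and let $$P_\lambda(z_1,\dots,z_{2n};t)=\frac1{v_\lambda(t)}\sum_{w\in S_{2n}}w\Big(z_1^{\lambda_1}\cdots z_{2n}^{\lambda_{2n}}\prod_{1\le i<j\le 2n}\frac{z_i-tz_j}{z_i-z_j}\Big)$$ be the Hall–Littlewood polynomial, where $w$ acts on the subscripts of the variables. Let $$\tilde\Delta_K^{(n)}(x;a,b,c,d;t)=\frac1{2^n n!}\prod_{i=1}^n\frac{1-x_i^{\pm2}}{(1-ax_i^{\pm1})(1-bx_i^{\pm1})(1-cx_i^{\pm1})(1-dx_i^{\pm1})}\prod_{1\le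 i<j\le n}\frac{1-x_i^{\pm1}x_j^{\pm1}}{1-tx_i^{\pm1}x_j^{\pm1}},$$ where a factor containing $\pm$ signs stands for the product over all choices of the signs, and write $\tilde\Delta_K^{(n)}(\pm1,\pm\sqrt t)=\tilde\Delta_K^{(n)}(x;1,-1,\sqrt t,-\sqrt t;t)$ (either square root may be used). Let $T=\{|x_1|=\dots=|x_n|=1\}$ and $dT=\prod_j\frac{dx_j}{2\pi\sqrt{-1}\,x_j}$. Then both integrals below converge absolutely, $\int_T\tilde\Delta_K^{(n)}(\pm1,\pm\sqrt t)\,dT\neq 0$, and $$\frac{1}{\int_T\tilde\Delta_K^{(n)}(\pm1,\pm\sqrt t)\,dT}\int_T P_\lambda(x_1^{\pm1},\dots,x_n^{\pm1};t)\,\tilde\Delta_K^{(n)}(\pm1,\pm\sqrt t)\prod_{i=1}^n(1-\alpha x_i^{\pm1})\,dT$$ $$=\frac{\phi_{2n}(t)}{v_\lambda(t)(1-t)^{2n}}\Big[(-\alpha)^{\#\{j\,:\,\lambda_j\text{ odd}\}}+(-\alpha)^{\#\{j\,:\,\lambda_j\text{ even}\}}\Big]=\frac{[2n]!}{v_\lambda(t)}\Big[(-\alpha)^{\#\{j\,:\,\lambda_j\text{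 odd}\}}+(-\alpha)^{\#\{j\,:\,\lambda_j\text{ even}\}}\Big],$$ where $j$ runs over $1,\dots,2n$, so that zero parts count as even parts. -/

import Mathlib

open scoped Real

namespace HallLittlewood

/-- The multiplicity `m_k(lam)`, i.e. the number of indices `i` with `lam i = k`
(zero parts are counted when `k = 0`). -/
def mult {N : ℕ} (lam : Fin N → ℕ) (k : ℕ) : ℕ :=
  (Finset.univ.filter fun i => lam i = k).card

/-- The number of odd parts of `lam = (lam_1, …, lam_N)`. -/
def numOdd {N : ℕ} (lam : Fin N → ℕ) : ℕ :=
  (Finset.univ.filter fun i => Odd (lam i)).card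

/-- The number of even parts of `lam = (lam_1, …, lam_N)`; zero parts are counted. -/
def numEven {N : ℕ} (lam : Fin N → ℕ) : ℕ :=
  (Finset.univ.filter fun i => Even (lam i)).card

/-- The `t`-integer `[m] = (1 - t ^ m) / (1 - t)`. -/
noncomputable def tInt (t : ℂ) (m : ℕ) : ℂ := (1 - t ^ m) / (1 - t)

/-- The `t`-factorial `[m]! = [m] [m-1] ⋯ [1]`, with `[0]! = 1`. -/
noncomputable def tFactorial (t : ℂ) (m : ℕ) : ℂ := ∏ j ∈ Finset.Icc 1 m, tInt t j

/-- `φ_r(t) = (1 - t) (1 - t ^ 2) ⋯ (1 - t ^ r)`. -/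
noncomputable def phi (t : ℂ) (r : ℕ) : ℂ := ∏ j ∈ Finset.Icc 1 r, (1 - t ^ j)

/-- `v_lam(t) = ∏_{k ≥ 0} [m_k(lam)]!`. Only the `k` that occur as parts of `lam` are listed,
all other factors being `[0]! = 1`. -/
noncomputable def v {N : ℕ} (t : ℂ) (lam : Fin N → ℕ) : ℂ :=
  ∏ k ∈ Finset.univ.image lam, tFactorial t (mult lam k)

/-- `y^lam ∏_{i < j} (y_i - t y_j) / (y_i - y_j)` for elements `y_1, …, y_N` of a field. -/
def symmTerm {K : Type*} [Field K] {N : ℕ} (t : K) (lam : Fin N → ℕ) (y : Fin N → K) : K :=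
  (∏ i, y i ^ lam i) * ∏ i, ∏ j ∈ Finset.Ioi i, (y i - t * y j) / (y i - y j)

section Existence

variable {N : ℕ}

/-- The substitution `X_i ↦ X_j`. -/
noncomputable def subst (i j : Fin N) :
    MvPolynomial (Fin N) ℂ →ₐ[ℂ] MvPolynomial (Fin N) ℂ :=
  MvPolynomial.aeval fun k => if k = i then MvPolynomial.X j else MvPolynomial.X k

theorem dvd_sub_subst (i j : Fin N) (p : MvPolynomial (Fin N) ℂ) :
    (MvPolynomial.X i - MvPolynomial.X j : MvPolynomial (Fin N) ℂ) ∣ p - subst i j p := by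
  rw [← Ideal.mem_span_singleton, ← Ideal.Quotient.eq]
  set I := Ideal.span {(MvPolynomial.X i - MvPolynomial.X j : MvPolynomial (Fin N) ℂ)}
  have h : (Ideal.Quotient.mkₐ ℂ I) = (Ideal.Quotient.mkₐ ℂ I).comp (subst i j) := by
    apply MvPolynomial.algHom_ext
    intro k
    by_cases hk : k = i
    · subst hk
      simp only [Ideal.Quotient.mkₐ_eq_mk, AlgHom.comp_apply, HallLittlewood.subst,
        MvPolynomial.aeval_X, if_true]
      rw [Ideal.Quotient.eq]
      exact Ideal.mem_span_singleton_self _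
    · simp [HallLittlewood.subst, hk]
  exact congrArg (fun f => f p) h

theorem sub_dvd_iff {i j : Fin N} (p : MvPolynomial (Fin N) ℂ) :
    (MvPolynomial.X i - MvPolynomial.X j : MvPolynomial (Fin N) ℂ) ∣ p ↔ subst i j p = 0 := by
  constructor
  · rintro ⟨q, rfl⟩
    have h : subst i j (MvPolynomial.X i - MvPolynomial.X j : MvPolynomial (Fin N) ℂ) = 0 := by
      by_cases hk : j = i <;> simp [subst, hk]
    rw [map_mul, h, zero_mul]
  · intro h
    simpa [h] using dvd_sub_subst i j p

theorem prime_sub {i j : Fin N} (hij : i ≠ j) :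
    Prime (MvPolynomial.X i - MvPolynomial.X j : MvPolynomial (Fin N) ℂ) := by
  have h0 : (MvPolynomial.X i - MvPolynomial.X j : MvPolynomial (Fin N) ℂ) ≠ 0 :=
    sub_ne_zero.2 fun h => hij (MvPolynomial.X_injective h)
  refine ⟨h0, fun hu => ?_, fun a b hab => ?_⟩
  · have := (sub_dvd_iff (i := i) (j := j) 1).1 hu.dvd
    simp at this
  · rw [sub_dvd_iff, map_mul, mul_eq_zero] at hab
    rwa [sub_dvd_iff, sub_dvd_iff]

/-- The Vandermonde product changes by the sign under a permutation of the variables. -/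
theorem prod_perm {R : Type*} [CommRing R] (y : Fin N → R) (w : Equiv.Perm (Fin N)) :
    ∏ i, ∏ j ∈ Finset.Ioi i, (y (w i) - y (w j)) =
      ((Equiv.Perm.sign w : ℤ) : R) * ∏ i, ∏ j ∈ Finset.Ioi i, (y i - y j) := by
  have h1 := Matrix.det_vandermonde fun i => -y i
  have h2 := Matrix.det_vandermonde fun i => -y (w i)
  have h3 : (Matrix.vandermonde fun i => -y (w i)) =
      (Matrix.vandermonde fun i => -y i).submatrix w id := by
    ext i j
    simp [Matrix.vandermonde]
  rw [h3, Matrix.det_permute, h1] at h2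
  simp only [neg_sub_neg] at h2
  exact h2.symm

/-- The alternating numerator of the symmetrized sum. -/
noncomputable def numer (t : ℂ) (lam : Fin N → ℕ) : MvPolynomial (Fin N) ℂ :=
  ∑ w : Equiv.Perm (Fin N), ((Equiv.Perm.sign w : ℤ) : MvPolynomial (Fin N) ℂ) *
    ((∏ i, MvPolynomial.X (w i) ^ lam i) *
      ∏ i, ∏ j ∈ Finset.Ioi i, (MvPolynomial.X (w i) - MvPolynomial.C t * MvPolynomial.X (w j)))

theorem subst_numer (t : ℂ) (lam : Fin N → ℕ) {i j : Fin N} (hij : i ≠ j) :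
    subst i j (numer t lam) = 0 := by
  set φ := subst i j with hφ
  have hX : ∀ k, φ (MvPolynomial.X (Equiv.swap i j k)) = φ (MvPolynomial.X k) := by
    intro k
    rcases eq_or_ne k i with rfl | hki
    · simp [hφ, subst, hij.symm]
    rcases eq_or_ne k j with rfl | hkj
    · simp [hφ, subst, hki]
    · rw [Equiv.swap_apply_of_ne_of_ne hki hkj]
  have hC : ∀ c, φ (MvPolynomial.C c) = MvPolynomial.C c := fun c => by simp [hφ, subst]
  have key : φ (numer t lam) = -φ (numer t lam) := by
    conv_lhs => rw [numer, map_sum]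
    rw [← Equiv.sum_comp (Equiv.mulLeft (Equiv.swap i j)), numer, map_sum,
      ← Finset.sum_neg_distrib]
    refine Finset.sum_congr rfl fun w _ => ?_
    simp only [Equiv.coe_mulLeft, map_mul, map_prod, map_pow, map_sub, hC, Equiv.Perm.mul_apply,
      hX, Equiv.Perm.sign_swap hij]
    simp
  have h2 : (2 : MvPolynomial (Fin N) ℂ) * φ (numer t lam) = 0 := by linear_combination key
  exact (mul_eq_zero.1 h2).resolve_left two_ne_zero

theorem prod_dvd_numer (t : ℂ) (lam : Fin N → ℕ) :
    (∏ i, ∏ j ∈ Finset.Ioi i,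
      (MvPolynomial.X i - MvPolynomial.X j : MvPolynomial (Fin N) ℂ)) ∣ numer t lam := by
  rw [Finset.prod_sigma']
  refine Finset.prod_dvd_of_isRelPrime ?_ ?_
  · rintro ⟨i, j⟩ hij ⟨k, l⟩ hkl hne
    simp only [Finset.coe_sigma, Set.mem_sigma_iff, Finset.mem_coe, Finset.mem_univ,
      Finset.mem_Ioi, true_and] at hij hkl
    change IsRelPrime (MvPolynomial.X i - MvPolynomial.X j : MvPolynomial (Fin N) ℂ)
      (MvPolynomial.X k - MvPolynomial.X l)
    rw [(prime_sub hij.ne).irreducible.isRelPrime_iff_not_dvd, sub_dvd_iff]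
    intro h
    have hinj : Function.Injective (MvPolynomial.X : Fin N → MvPolynomial (Fin N) ℂ) :=
      MvPolynomial.X_injective
    simp only [subst, map_sub, MvPolynomial.aeval_X, sub_eq_zero] at h
    split_ifs at h with h1 h2 h2
    · exact absurd (h1.trans h2.symm) hkl.ne
    · exact hne (by rw [h1, hinj h])
    · have h3 := hinj h
      subst h2 h3
      exact absurd hij hkl.not_gt
    · exact hkl.ne (hinj h)
  · rintro ⟨i, j⟩ hij
    simp only [Finset.mem_sigma, Finset.mem_univ, Finset.mem_Ioi, true_and] at hij
    exact (sub_dvd_iff _).2 (subst_numer t lam hij.ne)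

/-- Summing over all permutations with denominators cleared. -/
theorem sum_term {K : Type*} [Field K] (f : MvPolynomial (Fin N) ℂ →+* K)
    (hf : Function.Injective fun i => f (MvPolynomial.X i)) (t : ℂ) (lam : Fin N → ℕ) :
    (∑ w : Equiv.Perm (Fin N),
      symmTerm (f (MvPolynomial.C t)) lam fun i => f (MvPolynomial.X (w i))) *
      f (∏ i, ∏ j ∈ Finset.Ioi i, (MvPolynomial.X i - MvPolynomial.X j)) =
    f (numer t lam) := by
  rw [numer, map_sum, Finset.sum_mul]
  refine Finset.sum_congr rfl fun w _ => ?_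
  have h0 : ∏ i, ∏ j ∈ Finset.Ioi i, (f (MvPolynomial.X i) - f (MvPolynomial.X j)) ≠ 0 := by
    refine Finset.prod_ne_zero_iff.2 fun i _ => Finset.prod_ne_zero_iff.2 fun j hj => ?_
    exact sub_ne_zero.2 fun h => (Finset.mem_Ioi.1 hj).ne (hf h)
  have hw := prod_perm (fun i => f (MvPolynomial.X i)) w
  have hs : ((Equiv.Perm.sign w : ℤ) : K) * ((Equiv.Perm.sign w : ℤ) : K) = 1 := by
    rw [← Int.cast_mul, ← Units.val_mul, Int.units_mul_self]; simp
  have hs0 : ((Equiv.Perm.sign w : ℤ) : K) ≠ 0 := left_ne_zero_of_mul_eq_one hs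
  simp only [symmTerm, Finset.prod_div_distrib, hw, map_mul, map_prod, map_pow, map_sub, map_intCast]
  rw [mul_assoc, div_mul_eq_mul_div, ← div_div, mul_div_assoc, mul_div_assoc]
  field_simp
  linear_combination (-(∏ i, f (MvPolynomial.X (w i)) ^ lam i) * ∏ i, ∏ j ∈ Finset.Ioi i,
    (f (MvPolynomial.X (w i)) - f (MvPolynomial.C t) * f (MvPolynomial.X (w j)))) * hs

/-- The symmetrized sum, an element of the field of rational functions, is a polynomial. -/
theorem exists_R (t : ℂ) (lam : Fin N → ℕ) :
    ∃ p : MvPolynomial (Fin N) ℂ,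
      algebraMap _ (FractionRing (MvPolynomial (Fin N) ℂ)) p =
        ∑ w : Equiv.Perm (Fin N),
          symmTerm (algebraMap (MvPolynomial (Fin N) ℂ) (FractionRing (MvPolynomial (Fin N) ℂ)) (MvPolynomial.C t)) lam
            fun i => algebraMap (MvPolynomial (Fin N) ℂ) (FractionRing (MvPolynomial (Fin N) ℂ))
              (MvPolynomial.X (w i)) := by
  obtain ⟨p, hp⟩ := prod_dvd_numer t lam
  have hinj := IsFractionRing.injective (MvPolynomial (Fin N) ℂ)
    (FractionRing (MvPolynomial (Fin N) ℂ))
  have h := sum_term (algebraMap _ (FractionRing (MvPolynomial (Fin N) ℂ)))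
    (hinj.comp MvPolynomial.X_injective) t lam
  refine ⟨p, ?_⟩
  rw [hp, map_mul, mul_comm] at h
  refine (mul_left_cancel₀ ?_ h).symm
  rw [Ne, map_eq_zero_iff _ hinj]
  refine Finset.prod_ne_zero_iff.2 fun i _ => Finset.prod_ne_zero_iff.2 fun j hj => ?_
  exact (prime_sub (Finset.mem_Ioi.1 hj).ne).ne_zero

end Existence

/-- The polynomial `R_lam(x_1, …, x_N; t) = ∑_{w ∈ S_N} w(x^lam ∏_{i<j} (x_i - t x_j)/(x_i - x_j))`:
the unique polynomial equal to this sum in the field of rational functions in `x_1, …, x_N`. -/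
noncomputable def R {N : ℕ} (t : ℂ) (lam : Fin N → ℕ) : MvPolynomial (Fin N) ℂ :=
  (exists_R t lam).choose

/-- The Hall–Littlewood polynomial `P_lam(x_1, …, x_N; t) = R_lam(x_1, …, x_N; t) / v_lam(t)`. -/
noncomputable def P {N : ℕ} (t : ℂ) (lam : Fin N → ℕ) : MvPolynomial (Fin N) ℂ :=
  MvPolynomial.C (v t lam)⁻¹ * R t lam

/-- At points with distinct coordinates `R` is given by its defining sum. -/
theorem eval_R {N : ℕ} (t : ℂ) (lam : Fin N → ℕ) {x : Fin N → ℂ} (hx : Function.Injective x) :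
    MvPolynomial.eval x (R t lam) =
      ∑ w : Equiv.Perm (Fin N), symmTerm t lam fun i => x (w i) := by
  have hinj := IsFractionRing.injective (MvPolynomial (Fin N) ℂ)
    (FractionRing (MvPolynomial (Fin N) ℂ))
  have h1 := sum_term (algebraMap _ (FractionRing (MvPolynomial (Fin N) ℂ)))
    (hinj.comp MvPolynomial.X_injective) t lam
  rw [← (exists_R t lam).choose_spec, ← map_mul] at h1
  have h2 : R t lam * _ = numer t lam := hinj h1
  have h3 := sum_term (MvPolynomial.eval x) (by simpa using hx) t lam
  rw [← h2, map_mul] at h3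
  simp only [MvPolynomial.eval_C, MvPolynomial.eval_X] at h3
  refine (mul_right_cancel₀ ?_ h3).symm
  simp only [map_prod, map_sub, MvPolynomial.eval_X]
  refine Finset.prod_ne_zero_iff.2 fun i _ => Finset.prod_ne_zero_iff.2 fun j hj => ?_
  exact sub_ne_zero.2 fun h => (Finset.mem_Ioi.1 hj).ne (hx h)

end HallLittlewood

namespace Koornwinder

/-- The list of variables `(x_1, …, x_n, x_1⁻¹, …, x_n⁻¹)`. -/
noncomputable def pmVars {n : ℕ} (x : Fin n → ℂ) (k : Fin (2 * n)) : ℂ :=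
  if h : (k : ℕ) < n then x ⟨k, h⟩ else (x ⟨k - n, by omega⟩)⁻¹

/-- `(1 - a x)(1 - a x⁻¹)`, written `1 - a x^{±1}`. -/
noncomputable def pm (a x : ℂ) : ℂ := (1 - a * x) * (1 - a * x⁻¹)

/-- `(1 - c x y)(1 - c x⁻¹ y⁻¹)(1 - c x⁻¹ y)(1 - c x y⁻¹)`, written `1 - c x^{±1} y^{±1}`. -/
noncomputable def pm₂ (c x y : ℂ) : ℂ :=
  (1 - c * (x * y)) * (1 - c * (x⁻¹ * y⁻¹)) * (1 - c * (x⁻¹ * y)) * (1 - c * (x * y⁻¹))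

/-- The symmetric (`q = 0`) Koornwinder density in the variables `x_1, …, x_n`
with parameters `a, b, c, d; t`. -/
noncomputable def density {n : ℕ} (a b c d t : ℂ) (x : Fin n → ℂ) : ℂ :=
  1 / (2 ^ n * (n.factorial : ℂ)) *
    (∏ i, (1 - x i ^ 2) * (1 - (x i)⁻¹ ^ 2) / (pm a (x i) * pm b (x i) * pm c (x i) * pm d (x i))) *
    ∏ i, ∏ j ∈ Finset.Ioi i, pm₂ 1 (x i) (x j) / pm₂ t (x i) (x j)

/-- The integral of `f` over the torus `|z_1| = ⋯ = |z_n| = 1` against the Haar measure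
`dT = ∏_j dz_j / (2 π √-1 z_j)`. -/
noncomputable def integralT {n : ℕ} (f : (Fin n → ℂ) → ℂ) : ℂ :=
  torusIntegral (fun z => (∏ j, (2 * π * Complex.I * z j)⁻¹) * f z) 0 1

end Koornwinder

/-!
The weight on the torus is, off the null set where some `x_i = ±1`, a constant times
`W(x) = ∏ 1 / (1 - t x_i^{±2}) ∏_{i<j} (1 - x_i^{±1} x_j^{±1}) / (1 - t x_i^{±1} x_j^{±1})`.
Since `R_lam(x^{±1}) W(x) ∏ (1 - α x_i^{±1})` is holomorphic near the unit torus, Cauchy's theorem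
moves the integral to a torus with distinct radii `r_i` slightly less than `1`. There all letters
`x_1^{±1}, …, x_n^{±1}` are distinct, and `R_lam` may be replaced by its defining sum over the
arrangements `z_1, …, z_{2n}` of the letters. The summands have the form
`∏ h_c(z_c) ∏_{a<b} (z_a - t z_b) / (z_a - z_b) W(x)` with `h_c(z) = z^{lam_c} (1 - α z)`.

Let the letter in front be `u = x_i^{±1}`, with `u⁻¹` at position `b`. The factors that pair
`u^{±1}` with the other letters cancel against `W`, up to one Blaschke factor
`(t - u z) / (1 - t u z)` for every letter `z` between `u` and `u⁻¹`
(`arrangementTerm_insertPair`). What is left is `u / (u² - 1)` times a function of `u` holomorphic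
in a disc of radius greater than `1`; here `lam_1 ≥ lam_b` is used. Hence the integral over `x_i`
vanishes if `u = x_i`, as `|u| < 1` then, and if `u = x_i⁻¹` it is the sum of the residues at
`u = ε = ±1` (`circleAngleIntegral_arrangementTerm`). The remaining integral has the same shape with
one variable less, the `h_c` between the two removed positions being multiplied by a Blaschke
factor. Its value at a sign `η` is `-εη`, so that by induction the integral is a constant times
`∑ ∏ h_c(η_c)` over the sign vectors `η` with `∏ η_c = 1`
(`signSum_succ_succ`, `torusAngleIntegral_sum_arrangementTerm`). As the condition on `η` is imposed
by `(1 + ∏ η_c) / 2`, this sum factors and gives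
`2^{2n-1} ((-α)^{#odd} + (-α)^{#even})` (`signSum_pow`).

The normalization is the case `lam = 0`, `α = 0`, because `R_0 = [2n]!` (`sum_perm_kern`).
-/

namespace HallLittlewood

open MeasureTheory Set Metric

/-! ### Integrals over circles and tori in angular coordinates -/

/-- The integral of `φ` over the circle `|z| = r` against the angle `dθ = dz / (i z)`. -/
noncomputable def circleAngleIntegral (r : ℝ) (φ : ℂ → ℂ) : ℂ :=
  ∫ θ in Icc 0 (2 * π), φ (circleMap 0 r θ)

/-- The integral of `F` over the torus `|x_i| = r_i` against `∏ dθ_i`; the total mass of the torus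
is `(2π)^n`. -/
noncomputable def torusAngleIntegral {n : ℕ} (r : Fin n → ℝ) (F : (Fin n → ℂ) → ℂ) : ℂ :=
  ∫ θ in Icc (0 : Fin n → ℝ) (fun _ => 2 * π), F (torusMap 0 r θ)

/-- The open annulus `ρ⁻¹ < |z| < ρ`, which is stable under inversion. -/
def annulus (ρ : ℝ) : Set ℂ := {z | ρ⁻¹ < ‖z‖ ∧ ‖z‖ < ρ}

theorem isOpen_annulus (ρ : ℝ) : IsOpen (annulus ρ) :=
  (isOpen_lt continuous_const continuous_norm).inter (isOpen_lt continuous_norm continuous_const)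

theorem ne_zero_of_mem_annulus {ρ : ℝ} (hρ : 1 < ρ) {z : ℂ} (hz : z ∈ annulus ρ) : z ≠ 0 := by
  rintro rfl
  have := hz.1
  rw [norm_zero] at this
  exact absurd this (not_lt.2 (by positivity))

theorem inv_mem_annulus {ρ : ℝ} (hρ : 1 < ρ) {z : ℂ} (hz : z ∈ annulus ρ) : z⁻¹ ∈ annulus ρ := by
  have h0 : 0 < ‖z‖ := norm_pos_iff.2 (ne_zero_of_mem_annulus hρ hz)
  refine ⟨?_, ?_⟩
  · rw [norm_inv]; exact inv_strictAnti₀ h0 hz.2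
  · rw [norm_inv]; exact inv_lt_of_inv_lt₀ (by linarith) hz.1

theorem torusMap_apply_eq_circleMap {n : ℕ} (r : Fin n → ℝ) (θ : Fin n → ℝ) (i : Fin n) :
    torusMap 0 r θ i = circleMap 0 (r i) (θ i) := by
  simp [torusMap, circleMap]

theorem norm_torusMap_apply {n : ℕ} {r : Fin n → ℝ} (hr : ∀ i, 0 < r i) (θ : Fin n → ℝ)
    (i : Fin n) : ‖torusMap 0 r θ i‖ = r i := by
  rw [torusMap_apply_eq_circleMap, norm_circleMap_zero, abs_of_pos (hr i)]

theorem continuous_torusMap {n : ℕ} (r : Fin n → ℝ) : Continuous (torusMap (0 : Fin n → ℂ) r) := by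
  unfold torusMap
  fun_prop

/-- Fubini's theorem, with the distinguished coordinate integrated first. -/
theorem torusAngleIntegral_succAbove {n : ℕ} (r : Fin (n + 1) → ℝ) {F : (Fin (n + 1) → ℂ) → ℂ}
    (hF : Continuous fun θ => F (torusMap 0 r θ)) (i : Fin (n + 1)) :
    torusAngleIntegral r F = torusAngleIntegral (fun j => r (i.succAbove j)) fun y =>
      circleAngleIntegral (r i) fun x => F (i.insertNth x y) := by
  set e : ℝ × (Fin n → ℝ) ≃ᵐ (Fin (n + 1) → ℝ) :=
    (MeasurableEquiv.piFinSuccAbove (fun _ => ℝ) i).symm with he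
  have hem : MeasurePreserving e :=
    (volume_preserving_piFinSuccAbove (fun _ : Fin (n + 1) => ℝ) i).symm _
  have heπ : (e ⁻¹' Icc 0 fun _ => 2 * π) = Icc 0 (2 * π) ×ˢ Icc (0 : Fin n → ℝ) fun _ => 2 * π :=
    ((Fin.insertNthOrderIso (fun _ => ℝ) i).preimage_Icc _ _).trans (Icc_prod_eq _ _)
  have hint : IntegrableOn (fun θ => F (torusMap 0 r θ)) (Icc 0 fun _ => 2 * π) :=
    hF.integrableOn_Icc
  rw [torusAngleIntegral, ← hem.map_eq, setIntegral_map_equiv, heπ, Measure.volume_eq_prod]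
  rw [← hem.integrableOn_comp_preimage e.measurableEmbedding, heπ] at hint
  unfold IntegrableOn at hint
  rw [Measure.volume_eq_prod, ← Measure.prod_restrict] at hint
  rw [← Measure.prod_restrict]
  refine (integral_prod_symm _ hint).trans ?_
  refine integral_congr_ae (Filter.Eventually.of_forall fun Θ => ?_)
  refine integral_congr_ae (Filter.Eventually.of_forall fun θ => ?_)
  change F (torusMap 0 r (e (θ, Θ))) = F _
  congr 1
  funext j
  simp only [he]
  rw [torusMap_apply_eq_circleMap]
  rcases Fin.eq_self_or_eq_succAbove i j with rfl | ⟨k, rfl⟩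
  · simp [Fin.insertNthEquiv]
  · simp [Fin.insertNthEquiv, torusMap_apply_eq_circleMap]

theorem I_mul_circleAngleIntegral {r : ℝ} (hr : 0 < r) (φ : ℂ → ℂ) :
    Complex.I * circleAngleIntegral r φ = ∮ z in C(0, r), z⁻¹ • φ z := by
  rw [circleIntegral_def_Icc, circleAngleIntegral, ← integral_const_mul]
  refine integral_congr_ae (Filter.Eventually.of_forall fun θ => ?_)
  have h : circleMap 0 r θ ≠ 0 := circleMap_ne_center hr.ne'
  simp only [deriv_circleMap, smul_eq_mul]
  field_simp

theorem circleAngleIntegral_congr {r : ℝ} (hr : 0 < r) {φ ψ : ℂ → ℂ}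
    (h : ∀ z, ‖z‖ = r → φ z = ψ z) : circleAngleIntegral r φ = circleAngleIntegral r ψ := by
  unfold circleAngleIntegral
  congr 1
  funext θ
  exact h _ (by rw [norm_circleMap_zero, abs_of_pos hr])

theorem torusAngleIntegral_congr {n : ℕ} {r : Fin n → ℝ} (hr : ∀ i, 0 < r i)
    {F G : (Fin n → ℂ) → ℂ} (h : ∀ x, (∀ i, ‖x i‖ = r i) → F x = G x) :
    torusAngleIntegral r F = torusAngleIntegral r G := by
  unfold torusAngleIntegral
  congr 1
  funext θ
  exact h _ fun i => norm_torusMap_apply hr θ i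

theorem circleAngleIntegral_comp_inv {r : ℝ} (φ : ℂ → ℂ) :
    circleAngleIntegral r (fun z => φ z⁻¹) = circleAngleIntegral r⁻¹ φ := by
  unfold circleAngleIntegral
  rw [integral_Icc_eq_integral_Ioc, integral_Icc_eq_integral_Ioc,
    ← intervalIntegral.integral_of_le Real.two_pi_pos.le,
    ← intervalIntegral.integral_of_le Real.two_pi_pos.le]
  have h := intervalIntegral.integral_comp_sub_left (a := 0) (b := 2 * π)
    (fun θ => φ (circleMap 0 r⁻¹ θ)) (2 * π)
  rw [sub_self, sub_zero] at h
  rw [← h]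
  refine intervalIntegral.integral_congr fun θ _ => ?_
  have h1 : circleMap 0 r⁻¹ (2 * π - θ) = circleMap 0 r⁻¹ (-θ) := by
    rw [sub_eq_neg_add]; exact periodic_circleMap 0 r⁻¹ (-θ)
  simp only [h1, circleMap_zero_inv]

theorem circleAngleIntegral_eq_of_annulus {ρ r s : ℝ} (hρ : 1 < ρ) {φ : ℂ → ℂ}
    (hφ : DifferentiableOn ℂ φ (annulus ρ)) (hr : ρ⁻¹ < r ∧ r < ρ) (hs : ρ⁻¹ < s ∧ s < ρ) :
    circleAngleIntegral r φ = circleAngleIntegral s φ := by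
  wlog hrs : r ≤ s generalizing r s
  · exact (this hs hr (le_of_not_ge hrs)).symm
  have h0 : 0 < ρ⁻¹ := by positivity
  have hr0 := h0.trans hr.1
  have hs0 := h0.trans hs.1
  refine mul_left_cancel₀ Complex.I_ne_zero ?_
  rw [I_mul_circleAngleIntegral hr0, I_mul_circleAngleIntegral hs0]
  have h := Complex.circleIntegral_sub_center_inv_smul_eq_of_differentiable_on_annulus_off_countable
    (c := 0) hr0 hrs (f := φ) countable_empty ?_ ?_
  · simpa using h.symm
  · refine hφ.continuousOn.mono fun z hz => ?_
    simp only [mem_sdiff, mem_closedBall, dist_zero_right, mem_ball, not_lt] at hz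
    exact ⟨hr.1.trans_le hz.2, hz.1.trans_lt hs.2⟩
  · intro z hz
    simp only [sdiff_empty, mem_sdiff, mem_closedBall, dist_zero_right, mem_ball, not_le] at hz
    exact hφ.differentiableAt ((isOpen_annulus ρ).mem_nhds ⟨hr.1.trans hz.2, hz.1.trans hs.2⟩)

/-- Inside the unit circle `f(z) z / (z² - 1)` is holomorphic and vanishes at the origin. -/
theorem circleAngleIntegral_inside {ρ r : ℝ} (hρ : 1 < ρ) {f : ℂ → ℂ}
    (hf : DifferentiableOn ℂ f (ball 0 ρ)) (hr0 : 0 < r) (hr1 : r < 1) :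
    circleAngleIntegral r (fun z => f z * (z / (z ^ 2 - 1))) = 0 := by
  have hd : DifferentiableOn ℂ (fun z => f z * (z / (z ^ 2 - 1))) (closedBall 0 r) := by
    refine (hf.mono (closedBall_subset_ball (hr1.trans hρ))).mul
      (differentiableOn_id.div ((differentiableOn_id.pow 2).sub_const 1) fun z hz => ?_)
    rw [mem_closedBall, dist_zero_right] at hz
    intro h
    have h1 : ‖z‖ ^ 2 = 1 := by
      rw [← norm_pow, sub_eq_zero.1 h, norm_one]
    nlinarith [norm_nonneg z]
  refine mul_left_cancel₀ Complex.I_ne_zero ?_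
  rw [I_mul_circleAngleIntegral hr0]
  have h := hd.circleIntegral_sub_inv_smul (mem_ball_self hr0)
  simpa using h

theorem circleAngleIntegral_outside {ρ R : ℝ} {f : ℂ → ℂ}
    (hf : DifferentiableOn ℂ f (ball 0 ρ)) (hR1 : 1 < R) (hRρ : R < ρ) :
    circleAngleIntegral R (fun z => f z * (z / (z ^ 2 - 1))) = π * (f 1 - f (-1)) := by
  have hR0 : 0 < R := by linarith
  refine mul_left_cancel₀ Complex.I_ne_zero ?_
  rw [I_mul_circleAngleIntegral hR0]
  have hd : DifferentiableOn ℂ f (closedBall 0 R) := hf.mono (closedBall_subset_ball hRρ)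
  have h1 := hd.circleIntegral_sub_inv_smul (w := 1) (by simpa using hR1)
  have h2 := hd.circleIntegral_sub_inv_smul (w := -1) (by simpa using hR1)
  have hne : ∀ z ∈ sphere (0 : ℂ) R, z ≠ 0 ∧ z - 1 ≠ 0 ∧ z - -1 ≠ 0 := by
    intro z hz
    rw [mem_sphere, dist_zero_right] at hz
    refine ⟨?_, ?_, ?_⟩
    · rintro rfl; simp at hz; linarith
    · rw [sub_ne_zero]; rintro rfl; simp at hz; linarith
    · rw [sub_ne_zero]; rintro rfl; simp at hz; linarith
  have hi : ∀ w : ℂ, (∀ z ∈ sphere (0 : ℂ) R, z - w ≠ 0) →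
      CircleIntegrable (fun z => (z - w)⁻¹ • f z) 0 R := fun w hw =>
    (((continuousOn_id.sub continuousOn_const).inv₀ hw).smul
      (hd.continuousOn.mono sphere_subset_closedBall)).circleIntegrable hR0.le
  have hcongr : (∮ z in C(0, R), z⁻¹ • (f z * (z / (z ^ 2 - 1)))) =
      ∮ z in C(0, R), (1 / 2 : ℂ) • ((z - 1)⁻¹ • f z - (z - -1)⁻¹ • f z) := by
    refine circleIntegral.integral_congr hR0.le fun z hz => ?_
    obtain ⟨a, b, c⟩ := hne z hz
    have hsq : z ^ 2 - 1 ≠ 0 := by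
      rw [show z ^ 2 - 1 = (z - 1) * (z - -1) by ring]; exact mul_ne_zero b c
    simp only [smul_eq_mul]
    rw [show z ^ 2 - 1 = (z - 1) * (z - -1) by ring]
    field_simp
    ring
  rw [hcongr, circleIntegral.integral_smul, circleIntegral.integral_sub
    (hi 1 fun z hz => (hne z hz).2.1) (hi (-1) fun z hz => (hne z hz).2.2), h1, h2]
  simp only [smul_eq_mul]
  ring

/-- Moving one radius of the torus by Cauchy's theorem. -/
theorem torusAngleIntegral_update {n : ℕ} {ρ : ℝ} (hρ : 1 < ρ) {F : (Fin n → ℂ) → ℂ}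
    (hF : DifferentiableOn ℂ F {x | ∀ i, x i ∈ annulus ρ}) {r : Fin n → ℝ}
    (hr : ∀ i, ρ⁻¹ < r i ∧ r i < ρ) (i : Fin n) {s : ℝ} (hs : ρ⁻¹ < s ∧ s < ρ) :
    torusAngleIntegral (Function.update r i s) F = torusAngleIntegral r F := by
  have h0 : 0 < ρ⁻¹ := by positivity
  have hcont : ∀ r : Fin n → ℝ, (∀ i, ρ⁻¹ < r i ∧ r i < ρ) →
      Continuous fun θ => F (torusMap 0 r θ) := fun r hr =>
    hF.continuousOn.comp_continuous (continuous_torusMap r) fun θ j => by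
      rw [annulus, mem_ofPred_eq, norm_torusMap_apply fun i => h0.trans (hr i).1]; exact hr j
  have hr' : ∀ j, ρ⁻¹ < Function.update r i s j ∧ Function.update r i s j < ρ := by
    intro j
    rcases eq_or_ne j i with rfl | hj
    · simpa using hs
    · simpa [hj] using hr j
  cases n with
  | zero => exact i.elim0
  | succ n =>
    rw [torusAngleIntegral_succAbove _ (hcont _ hr') i, torusAngleIntegral_succAbove _ (hcont _ hr) i]
    simp only [Function.update_self, Function.update_of_ne (Fin.succAbove_ne i _)]
    refine torusAngleIntegral_congr (fun j => h0.trans (hr _).1) fun y hy => ?_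
    refine circleAngleIntegral_eq_of_annulus hρ ?_ hs (hr i)
    refine hF.comp (f := fun x : ℂ => (i.insertNth x y : Fin (n + 1) → ℂ)) ?_ ?_
    · rw [differentiableOn_pi]
      intro j
      rcases Fin.eq_self_or_eq_succAbove i j with rfl | ⟨k, rfl⟩
      · simp only [Fin.insertNth_apply_same]; exact differentiableOn_id
      · simp
    · intro x hx j
      rcases Fin.eq_self_or_eq_succAbove i j with rfl | ⟨k, rfl⟩
      · simpa using hx
      · simp only [Fin.insertNth_apply_succAbove, annulus, mem_ofPred_eq, hy]
        exact hr _

theorem torusAngleIntegral_eq_of_annulus {n : ℕ} {ρ : ℝ} (hρ : 1 < ρ) {F : (Fin n → ℂ) → ℂ}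
    (hF : DifferentiableOn ℂ F {x | ∀ i, x i ∈ annulus ρ}) {r s : Fin n → ℝ}
    (hr : ∀ i, ρ⁻¹ < r i ∧ r i < ρ) (hs : ∀ i, ρ⁻¹ < s i ∧ s i < ρ) :
    torusAngleIntegral r F = torusAngleIntegral s F := by
  have key : ∀ S : Finset (Fin n),
      torusAngleIntegral (fun i => if i ∈ S then r i else s i) F = torusAngleIntegral s F := by
    intro S
    induction S using Finset.induction_on with
    | empty => simp
    | insert a S ha ih =>
      rw [← ih, ← torusAngleIntegral_update hρ hF (r := fun i => if i ∈ S then r i else s i)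
        (fun i => by split_ifs; exacts [hr i, hs i]) a (hr a)]
      congr 1
      funext j
      rcases eq_or_ne j a with rfl | hj
      · simp
      · simp [hj]
  simpa using key Finset.univ

end HallLittlewood

namespace HallLittlewood

open Finset

/-! ### Products over pairs, and the sum over sign vectors -/

/-- Splitting off one index from a product over ordered pairs. -/
theorem prod_Ioi_succAbove {M : Type*} [CommMonoid M] {m : ℕ} (b : Fin (m + 1))
    (F : Fin (m + 1) → Fin (m + 1) → M) :
    ∏ i, ∏ j ∈ Ioi i, F i j =
      (∏ c, if b.succAbove c < b then F (b.succAbove c) b else F b (b.succAbove c)) *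
        ∏ c, ∏ d ∈ Ioi c, F (b.succAbove c) (b.succAbove d) := by
  have h : ∀ {k : ℕ} (G : Fin k → Fin k → M),
      ∏ i, ∏ j ∈ Ioi i, G i j = ∏ i, ∏ j, if i < j then G i j else 1 := by
    intro k G
    refine prod_congr rfl fun i _ => ?_
    rw [← prod_filter]
    congr 1
    ext j
    simp
  rw [h, h, Fin.prod_univ_succAbove _ b, Fin.prod_univ_succAbove _ b]
  simp_rw [Fin.prod_univ_succAbove _ b, prod_mul_distrib]
  simp only [lt_irrefl, if_false, one_mul, Fin.succAbove_lt_succAbove_iff]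
  rw [← mul_assoc, ← prod_mul_distrib]
  congr 1
  refine prod_congr rfl fun c _ => ?_
  rcases lt_or_gt_of_ne (Fin.succAbove_ne b c) with hc | hc
  · simp [hc, hc.not_gt]
  · simp [hc, hc.not_gt]

/-- `S(h) = ∑ ∏ h_c(η_c)`, the sum over the sign vectors `η` with `∏ η_c = 1`. -/
noncomputable def signSum {N : ℕ} (h : Fin N → ℂ → ℂ) : ℂ :=
  ∑ η : Fin N → ℤˣ, if ∏ c, η c = 1 then ∏ c, h c ((η c : ℤ) : ℂ) else 0

/-- The ratio `(t - u z) / (1 - t u z)` of the two orders of a pair of letters `z`, `u⁻¹`. -/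
noncomputable def blaschke (t u z : ℂ) : ℂ := (t - u * z) / (1 - t * u * z)

theorem blaschke_sign {t : ℂ} (ht : ‖t‖ < 1) (ε η : ℤˣ) :
    blaschke t ((ε : ℤ) : ℂ) ((η : ℤ) : ℂ) = -((ε * η : ℤˣ) : ℤ) := by
  have h1 : (1 : ℂ) - t ≠ 0 := sub_ne_zero.2 fun h => by rw [← h, norm_one] at ht; exact ht.false
  have h2 : (1 : ℂ) + t ≠ 0 := fun h => by
    rw [eq_neg_of_add_eq_zero_right h, norm_neg, norm_one] at ht; exact ht.false
  rcases Int.units_eq_one_or ε with rfl | rfl <;> rcases Int.units_eq_one_or η with rfl | rfl <;>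
    simp [blaschke]
  · rw [div_eq_iff h1]; ring
  · rw [add_comm, div_self h2]
  · rw [add_comm, div_self h2]
  · rw [div_eq_iff h1]; ring

/-- For an odd number of signs with product `1`, the alternating sum over the positions of the
plus signs is `1`. -/
theorem sum_alternating_signs {M : ℕ} (hM : Odd M) (s : Fin M → ℤˣ) (hs : ∏ c, s c = 1) :
    ∑ b, (if s b = 1 then ∏ c with c < b, (-((s c : ℤ) : ℂ)) else 0) = 1 := by
  have h := prod_one_sub_ordered univ fun c => 1 + ((s c : ℤ) : ℂ)
  have h1 : ∏ c, (1 - (1 + ((s c : ℤ) : ℂ))) = -1 := by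
    simp only [sub_add_cancel_left]
    have h2 : ((∏ c, (s c : ℤˣ) : ℤˣ) : ℤ) = 1 := by rw [hs]; rfl
    rw [Finset.prod_neg, Finset.card_univ, Fintype.card_fin, hM.neg_one_pow]
    rw [Units.coe_prod] at h2
    rw [← Int.cast_prod, h2]
    simp
  rw [h1] at h
  have h3 : ∑ b, (1 + ((s b : ℤ) : ℂ)) * ∏ c with c < b, (1 - (1 + ((s c : ℤ) : ℂ))) = 2 := by
    linear_combination h
  have h4 : ∀ b, (1 + ((s b : ℤ) : ℂ)) * ∏ c with c < b, (1 - (1 + ((s c : ℤ) : ℂ))) =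
      2 * (if s b = 1 then ∏ c with c < b, (-((s c : ℤ) : ℂ)) else 0) := by
    intro b
    simp only [sub_add_cancel_left]
    rcases Int.units_eq_one_or (s b) with hb | hb
    · rw [if_pos hb, hb, Units.val_one, Int.cast_one, one_add_one_eq_two]
    · simp [hb]
  rw [sum_congr rfl fun b _ => h4 b, ← mul_sum] at h3
  exact mul_left_cancel₀ two_ne_zero (h3.trans (mul_one 2).symm)

/-- The sequence that remains after the removal of the entries `0` and `b + 1`; the entries between
the two removed ones are multiplied by Blaschke factors. -/
noncomputable def removePair (t : ℂ) {N : ℕ} (h : Fin (N + 2) → ℂ → ℂ) (b : Fin (N + 1)) (u : ℂ) :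
    Fin N → ℂ → ℂ :=
  fun c z => h (b.succAbove c).succ z * if b.succAbove c < b then blaschke t u z else 1

/-- The recursion satisfied by `signSum`: fix a sign vector and sum over the positions `b` with the
same sign as the front entry. The Blaschke factors make this sum alternating, so that it is `1`. -/
theorem signSum_succ_succ {t : ℂ} (ht : ‖t‖ < 1) {N : ℕ} (hN : Even N)
    (h : Fin (N + 2) → ℂ → ℂ) :
    ∑ b : Fin (N + 1), ∑ ε : ℤˣ, h 0 ((ε : ℤ) : ℂ) * h b.succ ((ε : ℤ) : ℂ) *
      signSum (removePair t h b ((ε : ℤ) : ℂ)) = signSum h := by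
  have hR : signSum h = ∑ ε : ℤˣ, ∑ ζ : Fin (N + 1) → ℤˣ, if ε * ∏ c, ζ c = 1 then
      h 0 ((ε : ℤ) : ℂ) * ∏ c, h (Fin.succ c) ((ζ c : ℤ) : ℂ) else 0 := by
    rw [signSum, ← (Fin.consEquiv fun _ : Fin (N + 2) => ℤˣ).sum_comp, Fintype.sum_prod_type]
    simp [Fin.consEquiv, Fin.prod_univ_succ]
  rw [hR, sum_comm]
  refine sum_congr rfl fun ε _ => ?_
  have hL : ∀ b : Fin (N + 1), h 0 ((ε : ℤ) : ℂ) * h b.succ ((ε : ℤ) : ℂ) *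
      signSum (removePair t h b ((ε : ℤ) : ℂ)) = ∑ ζ : Fin (N + 1) → ℤˣ,
        if ε * ∏ c, ζ c = 1 then (h 0 ((ε : ℤ) : ℂ) * ∏ c, h (Fin.succ c) ((ζ c : ℤ) : ℂ)) *
          (if ε * ζ b = 1 then ∏ c with c < b, (-(((ε * ζ c : ℤˣ) : ℤ) : ℂ)) else 0) else 0 := by
    intro b
    rw [← (Fin.insertNthEquiv (fun _ : Fin (N + 1) => ℤˣ) b).sum_comp, Fintype.sum_prod_type,
      Fintype.sum_eq_single ε]
    · rw [signSum, mul_sum]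
      refine sum_congr rfl fun η _ => ?_
      have hp : ∏ c with c < b, (-(((ε * (b.insertNth ε η : Fin (N + 1) → ℤˣ) c : ℤˣ) : ℤ) : ℂ)) =
          ∏ c, if b.succAbove c < b then blaschke t ((ε : ℤ) : ℂ) ((η c : ℤ) : ℂ) else 1 := by
        rw [prod_filter, Fin.prod_univ_succAbove _ b]
        simp [blaschke_sign ht]
      simp only [Fin.insertNthEquiv, Equiv.coe_fn_mk, hp, Fin.insertNth_apply_same,
        Int.units_mul_self, if_true]
      simp only [Fin.prod_univ_succAbove _ b, Fin.insertNth_apply_same,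
        Fin.insertNth_apply_succAbove, ← mul_assoc, Int.units_mul_self, one_mul, removePair,
        prod_mul_distrib]
      split_ifs <;> ring
    · intro δ hδ
      refine sum_eq_zero fun η _ => ?_
      have : ε * δ ≠ 1 := fun h => hδ (by
        have := congrArg (ε * ·) h
        simpa [← mul_assoc, Int.units_mul_self] using this)
      simp [Fin.insertNthEquiv, this]
  rw [sum_congr rfl fun b _ => hL b, sum_comm]
  refine sum_congr rfl fun ζ _ => ?_
  split_ifs with hζ
  · rw [← mul_sum, sum_alternating_signs (hN.add_one) (fun c => ε * ζ c), mul_one]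
    rw [prod_mul_distrib, prod_const, card_univ, Fintype.card_fin, pow_succ,
      show ε ^ N = 1 by
        obtain ⟨k, rfl⟩ := hN
        rw [← two_mul, pow_mul, sq, Int.units_mul_self, one_pow], one_mul, hζ]
  · simp

/-- `signSum` of the sequence that belongs to the Hall–Littlewood polynomial. -/
theorem signSum_pow {N : ℕ} (lam : Fin N → ℕ) (α : ℂ) :
    2 * signSum (fun c z => z ^ lam c * (1 - α * z)) =
      2 ^ N * ((-α) ^ numOdd lam + (-α) ^ numEven lam) := by
  have h1 : ∀ f : Fin N → ℤˣ → ℂ, ∑ η : Fin N → ℤˣ, ∏ c, f c (η c) = ∏ c, (f c 1 + f c (-1)) := by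
    intro f
    rw [← Fintype.prod_sum]
    refine prod_congr rfl fun c _ => ?_
    rw [show (univ : Finset ℤˣ) = {1, -1} from rfl, sum_pair (by decide)]
  have h2 : ∀ (P : ℕ → Prop) [DecidablePred P],
      ∏ c, (if P (lam c) then (-2 * α) else (2 : ℂ)) =
        2 ^ N * (-α) ^ (univ.filter fun i => P (lam i)).card := by
    intro P _
    have : ∀ c, (if P (lam c) then (-2 * α) else (2 : ℂ)) = 2 * if P (lam c) then -α else 1 := by
      intro c; split_ifs <;> ring
    rw [prod_congr rfl fun c _ => this c, prod_mul_distrib, prod_const, card_univ,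
      Fintype.card_fin, prod_ite]
    simp
  have h3 : 2 * signSum (fun c z => z ^ lam c * (1 - α * z)) =
      ∑ η : Fin N → ℤˣ, ∏ c, (((η c : ℤ) : ℂ) ^ lam c * (1 - α * ((η c : ℤ) : ℂ))) +
      ∑ η : Fin N → ℤˣ, ∏ c,
        (((η c : ℤ) : ℂ) * (((η c : ℤ) : ℂ) ^ lam c * (1 - α * ((η c : ℤ) : ℂ)))) := by
    rw [signSum, mul_sum, ← sum_add_distrib]
    refine sum_congr rfl fun η _ => ?_
    rw [prod_mul_distrib (f := fun c => ((η c : ℤ) : ℂ)), ← Int.cast_prod, ← Units.coe_prod]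
    rcases Int.units_eq_one_or (∏ c, η c) with hη | hη
    · simp [hη]; ring
    · simp [hη]
  rw [h3, h1 (fun c e => ((e : ℤ) : ℂ) ^ lam c * (1 - α * ((e : ℤ) : ℂ))),
    h1 (fun c e => ((e : ℤ) : ℂ) * (((e : ℤ) : ℂ) ^ lam c * (1 - α * ((e : ℤ) : ℂ))))]
  rw [numOdd, numEven, mul_add, ← h2, ← h2]
  congr 1
  · refine prod_congr rfl fun c _ => ?_
    rcases Nat.even_or_odd (lam c) with hc | hc
    · simp [hc.neg_one_pow, Nat.not_odd_iff_even.2 hc]; ring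
    · simp [hc.neg_one_pow, hc]; ring
  · refine prod_congr rfl fun c _ => ?_
    rcases Nat.even_or_odd (lam c) with hc | hc
    · simp [hc.neg_one_pow, hc]; ring
    · simp [hc.neg_one_pow, Nat.not_even_iff_odd.2 hc]; ring

end HallLittlewood

namespace HallLittlewood

open Finset Koornwinder

/-! ### Arrangements of the letters `x_1^{±1}, …, x_n^{±1}` -/

/-- The letter `x_i` for `(i, true)` and `x_i⁻¹` for `(i, false)`. -/
noncomputable def letter {n : ℕ} (x : Fin n → ℂ) (p : Fin n × Bool) : ℂ :=
  if p.2 then x p.1 else (x p.1)⁻¹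

theorem letter_not {n : ℕ} (x : Fin n → ℂ) (i : Fin n) (σ : Bool) :
    letter x (i, !σ) = (letter x (i, σ))⁻¹ := by
  cases σ <;> simp [letter]

theorem insertPair_bijective {n N : ℕ} (i : Fin (n + 1)) (σ : Bool) (b : Fin (N + 1))
    (e : Fin N ≃ Fin n × Bool) :
    Function.Bijective (Fin.cons (i, σ) (b.insertNth (i, !σ)
      fun c => (i.succAbove (e c).1, (e c).2)) : Fin (N + 2) → Fin (n + 1) × Bool) := by
  rw [Fintype.bijective_iff_injective_and_card]
  constructor
  · rw [Fin.cons_injective_iff]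
    constructor
    · rintro ⟨c, hc⟩
      rcases Fin.eq_self_or_eq_succAbove b c with rfl | ⟨c, rfl⟩
      · simp at hc
      · simp only [Fin.insertNth_apply_succAbove, Prod.mk.injEq] at hc
        exact Fin.succAbove_ne _ _ hc.1
    · intro c d hcd
      rcases Fin.eq_self_or_eq_succAbove b c with hc | ⟨c, rfl⟩ <;>
        rcases Fin.eq_self_or_eq_succAbove b d with hd | ⟨d, rfl⟩
      · exact hc.trans hd.symm
      · simp only [hc, Fin.insertNth_apply_same, Fin.insertNth_apply_succAbove,
          Prod.mk.injEq] at hcd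
        exact absurd hcd.1.symm (Fin.succAbove_ne _ _)
      · simp only [hd, Fin.insertNth_apply_same, Fin.insertNth_apply_succAbove,
          Prod.mk.injEq] at hcd
        exact absurd hcd.1 (Fin.succAbove_ne _ _)
      · simp only [Fin.insertNth_apply_succAbove, Prod.mk.injEq,
          Fin.succAbove_right_injective.eq_iff] at hcd
        rw [e.injective (Prod.ext hcd.1 hcd.2)]
  · have h := Fintype.card_congr e
    simp only [Fintype.card_fin, Fintype.card_prod, Fintype.card_bool] at h ⊢
    omega

/-- The arrangement with the letter `(i, σ)` in front, its inverse at position `b + 1`, and the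
other letters arranged by `e`. -/
noncomputable def insertPair {n N : ℕ} (i : Fin (n + 1)) (σ : Bool) (b : Fin (N + 1))
    (e : Fin N ≃ Fin n × Bool) : Fin (N + 2) ≃ Fin (n + 1) × Bool :=
  Equiv.ofBijective _ (insertPair_bijective i σ b e)

section insertPair

variable {n N : ℕ} (i : Fin (n + 1)) (σ : Bool) (b : Fin (N + 1)) (e : Fin N ≃ Fin n × Bool)

theorem insertPair_zero : insertPair i σ b e 0 = (i, σ) := by
  simp [insertPair]

theorem insertPair_succ_same : insertPair i σ b e b.succ = (i, !σ) := by
  simp [insertPair]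

theorem insertPair_succ_succAbove (c : Fin N) :
    insertPair i σ b e (b.succAbove c).succ = (i.succAbove (e c).1, (e c).2) := by
  simp [insertPair]

end insertPair

/-- Every arrangement is obtained exactly once by `insertPair`. -/
theorem sum_insertPair {n N : ℕ} (hN : N = 2 * n) (Φ : (Fin (N + 2) ≃ Fin (n + 1) × Bool) → ℂ) :
    ∑ e, Φ e = ∑ i, ∑ σ, ∑ b, ∑ e : Fin N ≃ Fin n × Bool, Φ (insertPair i σ b e) := by
  have e0 : Fin N ≃ Fin n × Bool := Fintype.equivOfCardEq (by simp [hN, mul_comm])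
  have hbij : Function.Bijective fun q : Fin (n + 1) × Bool × Fin (N + 1) × (Fin N ≃ Fin n × Bool) =>
      insertPair q.1 q.2.1 q.2.2.1 q.2.2.2 := by
    rw [Fintype.bijective_iff_injective_and_card]
    constructor
    · rintro ⟨i, σ, b, e⟩ ⟨i', σ', b', e'⟩ h
      simp only at h
      have h0 := congrArg (fun f => f 0) h
      simp only [insertPair_zero, Prod.mk.injEq] at h0
      obtain ⟨rfl, rfl⟩ := h0
      have hb := congrArg (fun f => f b.succ) h
      simp only [insertPair_succ_same] at hb
      rcases Fin.eq_self_or_eq_succAbove b' b with rfl | ⟨c, rfl⟩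
      · have he : e = e' := by
          ext1 c
          have hc := congrArg (fun f => f (b.succAbove c).succ) h
          simp only [insertPair_succ_succAbove, Prod.mk.injEq,
            Fin.succAbove_right_injective.eq_iff] at hc
          exact Prod.ext hc.1 hc.2
        rw [he]
      · simp only [insertPair_succ_succAbove, Prod.mk.injEq] at hb
        exact absurd hb.1.symm (Fin.succAbove_ne _ _)
    · simp only [Fintype.card_prod, Fintype.card_fin, Fintype.card_bool, Fintype.card_equiv e0,
        Fintype.card_equiv (insertPair 0 true 0 e0), Nat.factorial_succ]
      rw [hN]
      ring
  rw [← hbij.sum_comp Φ]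
  simp only [Fintype.sum_prod_type]

/-! ### The integrand attached to one arrangement -/

/-- The product `∏_{a < b} (z_a - t z_b) / (z_a - z_b)`. -/
noncomputable def kern {N : ℕ} (t : ℂ) (z : Fin N → ℂ) : ℂ :=
  ∏ i, ∏ j ∈ Ioi i, (z i - t * z j) / (z i - z j)

/-- The Koornwinder density with parameters `±1, ±√t`, without its constant factor and after
cancellation of `1 - x_i^{±2}`. -/
noncomputable def weight {n : ℕ} (t : ℂ) (x : Fin n → ℂ) : ℂ :=
  (∏ i, ((1 - t * x i ^ 2) * (1 - t * (x i)⁻¹ ^ 2))⁻¹) *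
    ∏ i, ∏ j ∈ Ioi i, pm₂ 1 (x i) (x j) / pm₂ t (x i) (x j)

/-- The summand `∏ h_c(z_c) ∏_{a < b} (z_a - t z_b) / (z_a - z_b)` times the weight, where
`z_1, z_2, …` are the letters `x_i^{±1}` in the order `e`. -/
noncomputable def arrangementTerm {n N : ℕ} (t : ℂ) (h : Fin N → ℂ → ℂ)
    (e : Fin N ≃ Fin n × Bool) (x : Fin n → ℂ) : ℂ :=
  (∏ c, h c (letter x (e c))) * kern t (fun c => letter x (e c)) * weight t x

theorem pm₂_comm (c x y : ℂ) : pm₂ c x y = pm₂ c y x := by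
  unfold pm₂; ring

theorem pm₂_inv_left (c x y : ℂ) : pm₂ c x⁻¹ y = pm₂ c x y := by
  unfold pm₂; rw [inv_inv]; ring

theorem kern_cons_insertNth {N : ℕ} (t u v : ℂ) (b : Fin (N + 1)) (z : Fin N → ℂ)
    (w : Fin (N + 2) → ℂ) (h0 : w 0 = u) (hb : w b.succ = v)
    (hz : ∀ c, w (b.succAbove c).succ = z c) :
    kern t w = (u - t * v) / (u - v) * (∏ c, (u - t * z c) / (u - z c)) *
      (∏ c, if b.succAbove c < b then (z c - t * v) / (z c - v) else (v - t * z c) / (v - z c)) *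
      kern t z := by
  unfold kern
  rw [prod_Ioi_succAbove 0]
  simp only [Fin.zero_succAbove, Fin.not_lt_zero, if_false]
  rw [prod_Ioi_succAbove b, Fin.prod_univ_succAbove _ b]
  simp only [h0, hb, hz]
  ring

theorem weight_insertNth {n : ℕ} (t x : ℂ) (i : Fin (n + 1)) (y : Fin n → ℂ) :
    weight t (i.insertNth x y : Fin (n + 1) → ℂ) =
      ((1 - t * x ^ 2) * (1 - t * x⁻¹ ^ 2))⁻¹ * (∏ j, pm₂ 1 x (y j) / pm₂ t x (y j)) *
        weight t y := by
  unfold weight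
  rw [prod_Ioi_succAbove i, Fin.prod_univ_succAbove _ i]
  simp only [Fin.insertNth_apply_same, Fin.insertNth_apply_succAbove, pm₂_comm _ _ x, ite_self]
  ring

theorem prod_letter {n N : ℕ} (f : ℂ → ℂ) (e : Fin N ≃ Fin n × Bool) (y : Fin n → ℂ) :
    ∏ c, f (letter y (e c)) = ∏ j, (f (y j) * f (y j)⁻¹) := by
  rw [e.prod_comp fun p => f (letter y p), Fintype.prod_prod_type]
  simp [letter]

/-- The four ratios of the letters `u^{±1}` to `y^{±1}` cancel the weight. -/
theorem pm₂_div_mul_eq_one {t u y : ℂ} (hu : u ≠ 0) (hy : y ≠ 0)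
    (h1 : u ≠ y) (h2 : u ≠ y⁻¹) (h5 : pm₂ t u y ≠ 0) :
    pm₂ 1 u y / pm₂ t u y * (((u - t * y) / (u - y) * ((u - t * y⁻¹) / (u - y⁻¹))) *
      ((u⁻¹ - t * y) / (u⁻¹ - y) * ((u⁻¹ - t * y⁻¹) / (u⁻¹ - y⁻¹)))) = 1 := by
  have a1 : u - y ≠ 0 := sub_ne_zero.2 h1
  have a2 : u - y⁻¹ ≠ 0 := sub_ne_zero.2 h2
  have a3 : u⁻¹ - y ≠ 0 := sub_ne_zero.2 fun h => h2 (by rw [← h, inv_inv])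
  have a4 : u⁻¹ - y⁻¹ ≠ 0 := sub_ne_zero.2 fun h => h1 (inv_injective h)
  have e1 : ∀ c : ℂ, (u - c * y) * (u - c * y⁻¹) * ((u⁻¹ - c * y) * (u⁻¹ - c * y⁻¹)) =
      pm₂ c u y := by
    intro c; unfold pm₂; field_simp
  have e2 := e1 1
  simp only [one_mul] at e2
  have e3 : (((u - t * y) / (u - y) * ((u - t * y⁻¹) / (u - y⁻¹))) *
      ((u⁻¹ - t * y) / (u⁻¹ - y) * ((u⁻¹ - t * y⁻¹) / (u⁻¹ - y⁻¹)))) = pm₂ t u y / pm₂ 1 u y := by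
    rw [← e1 t, ← e2, div_mul_div_comm, div_mul_div_comm, div_mul_div_comm]
  have e4 : pm₂ 1 u y ≠ 0 := by
    rw [← e2]
    exact mul_ne_zero (mul_ne_zero a1 a2) (mul_ne_zero a3 a4)
  rw [e3]
  field_simp

/-- Exchanging the order of the letters `z` and `u⁻¹` costs a Blaschke factor. -/
theorem swap_ratio_eq {t u z : ℂ} (hu : u ≠ 0) (h1 : u⁻¹ ≠ z) (h2 : 1 - t * u * z ≠ 0) :
    (z - t * u⁻¹) / (z - u⁻¹) = (u⁻¹ - t * z) / (u⁻¹ - z) * blaschke t u z := by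
  have a1 : u⁻¹ - z ≠ 0 := sub_ne_zero.2 h1
  have a2 : z - u⁻¹ ≠ 0 := sub_ne_zero.2 h1.symm
  have a3 : 1 - u * z ≠ 0 := fun h => a1 (by field_simp; simpa using h)
  have a4 : u * z - 1 ≠ 0 := fun h => a3 (by linear_combination -h)
  unfold blaschke
  rw [show z - t * u⁻¹ = (u * z - t) / u by field_simp,
    show z - u⁻¹ = (u * z - 1) / u by field_simp,
    show u⁻¹ - t * z = (1 - t * u * z) / u by field_simp,
    show u⁻¹ - z = (1 - u * z) / u by field_simp,
    div_div_div_cancel_right₀ hu, div_div_div_cancel_right₀ hu, div_mul_div_comm,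
    div_eq_div_iff a4 (mul_ne_zero a3 h2)]
  ring

/-- The dependence of a term on the variable `x` that provides the first letter `u = x^{±1}`. -/
theorem arrangementTerm_insertPair {n N : ℕ} {t x : ℂ} (h : Fin (N + 2) → ℂ → ℂ)
    (i : Fin (n + 1)) (σ : Bool) (b : Fin (N + 1)) (e : Fin N ≃ Fin n × Bool) (y : Fin n → ℂ)
    {u : ℂ} (hu : u = if σ then x else x⁻¹) (hu0 : u ≠ 0) (hu1 : u ^ 2 ≠ 1)
    (htu' : 1 - t * u⁻¹ ^ 2 ≠ 0) (hy : ∀ j, y j ≠ 0)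
    (hne : ∀ j, u ≠ y j ∧ u ≠ (y j)⁻¹) (hpm : ∀ j, pm₂ t u (y j) ≠ 0)
    (hz : ∀ p, 1 - t * u * letter y p ≠ 0) :
    arrangementTerm t h (insertPair i σ b e) (i.insertNth x y) =
      (u * (h 0 u * h b.succ u⁻¹) * ((1 - t * u ^ 2)⁻¹ *
        ∏ c, if b.succAbove c < b then blaschke t u (letter y (e c)) else 1)) *
        (u / (u ^ 2 - 1)) *
      ((∏ c, h (b.succAbove c).succ (letter y (e c))) * kern t (fun c => letter y (e c)) *
        weight t y) := by
  have l0 : letter (i.insertNth x y : Fin (n + 1) → ℂ) (i, σ) = u := by simp [letter, hu]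
  have l1 : letter (i.insertNth x y : Fin (n + 1) → ℂ) (i, !σ) = u⁻¹ := by rw [letter_not, l0]
  have l2 : ∀ p : Fin n × Bool,
      letter (i.insertNth x y : Fin (n + 1) → ℂ) (i.succAbove p.1, p.2) = letter y p := by
    intro p; simp [letter]
  have hw : weight t (i.insertNth x y : Fin (n + 1) → ℂ) =
      ((1 - t * u ^ 2) * (1 - t * u⁻¹ ^ 2))⁻¹ * (∏ j, pm₂ 1 u (y j) / pm₂ t u (y j)) *
        weight t y := by
    rw [weight_insertNth, hu]
    cases σ
    · simp [pm₂_inv_left, mul_comm]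
    · simp
  have hk := kern_cons_insertNth t u u⁻¹ b (fun c => letter y (e c))
    (fun c => letter (i.insertNth x y : Fin (n + 1) → ℂ) (insertPair i σ b e c))
    (by rw [insertPair_zero, l0]) (by rw [insertPair_succ_same, l1])
    (fun c => by rw [insertPair_succ_succAbove, l2])
  have hh : ∏ c, h c (letter (i.insertNth x y : Fin (n + 1) → ℂ) (insertPair i σ b e c)) =
      h 0 u * (h b.succ u⁻¹ * ∏ c, h (b.succAbove c).succ (letter y (e c))) := by
    rw [Fin.prod_univ_succ, Fin.prod_univ_succAbove _ b]
    simp only [insertPair_zero, insertPair_succ_same, insertPair_succ_succAbove, l0, l1, l2]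
  have hinv : ∀ p, u⁻¹ ≠ letter y p := by
    rintro ⟨j, τ⟩ hp
    cases τ
    · simp only [letter] at hp
      exact (hne j).1 (inv_injective (by simpa using hp))
    · simp only [letter, if_true] at hp
      exact (hne j).2 (by rw [← hp, inv_inv])
  have hb : (∏ c, if b.succAbove c < b then (letter y (e c) - t * u⁻¹) / (letter y (e c) - u⁻¹)
        else (u⁻¹ - t * letter y (e c)) / (u⁻¹ - letter y (e c))) =
      (∏ c, (u⁻¹ - t * letter y (e c)) / (u⁻¹ - letter y (e c))) *
        ∏ c, if b.succAbove c < b then blaschke t u (letter y (e c)) else 1 := by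
    rw [← prod_mul_distrib]
    refine prod_congr rfl fun c _ => ?_
    split_ifs
    · exact swap_ratio_eq hu0 (hinv _) (hz _)
    · rw [mul_one]
  have hcancel : (∏ j, pm₂ 1 u (y j) / pm₂ t u (y j)) *
      ((∏ c, (u - t * letter y (e c)) / (u - letter y (e c))) *
        ∏ c, (u⁻¹ - t * letter y (e c)) / (u⁻¹ - letter y (e c))) = 1 := by
    rw [prod_letter (fun z => (u - t * z) / (u - z)) e,
      prod_letter (fun z => (u⁻¹ - t * z) / (u⁻¹ - z)) e, ← prod_mul_distrib, ← prod_mul_distrib]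
    exact prod_eq_one fun j _ =>
      pm₂_div_mul_eq_one hu0 (hy j) (hne j).1 (hne j).2 (hpm j)
  have hself : (u - t * u⁻¹) / (u - u⁻¹) * ((1 - t * u ^ 2) * (1 - t * u⁻¹ ^ 2))⁻¹ =
      u * (1 - t * u ^ 2)⁻¹ * (u / (u ^ 2 - 1)) := by
    have a1 : u ^ 2 - 1 ≠ 0 := sub_ne_zero.2 hu1
    rw [mul_inv, show u - t * u⁻¹ = u * (1 - t * u⁻¹ ^ 2) by field_simp,
      show u - u⁻¹ = (u ^ 2 - 1) / u by field_simp]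
    generalize 1 - t * u⁻¹ ^ 2 = A at *
    field_simp
  rw [arrangementTerm, hh, hk, hw, hb]
  linear_combination (h 0 u * h b.succ u⁻¹ * (∏ c, h (b.succAbove c).succ (letter y (e c))) *
    (∏ c, if b.succAbove c < b then blaschke t u (letter y (e c)) else 1) *
    kern t (fun c => letter y (e c)) * weight t y) *
    ((u - t * u⁻¹) / (u - u⁻¹) * ((1 - t * u ^ 2) * (1 - t * u⁻¹ ^ 2))⁻¹ * hcancel + hself)

end HallLittlewood

namespace HallLittlewood

open Finset Koornwinder

/-! ### Integration of one variable -/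

/-- The condition on the factors `h_c` under which the front variable can be integrated: for
`a < b` the product `z h_a(z) h_b(z⁻¹)` extends holomorphically from the annulus to the disc. The
factor `z` absorbs the pole at `0` that `(1 - α z) (1 - α z⁻¹)` causes when `lam_a = lam_b`. -/
structure Admissible (ρ : ℝ) {N : ℕ} (h : Fin N → ℂ → ℂ) : Prop where
  continuousOn : ∀ c, ContinuousOn (h c) (annulus ρ)
  extends_to_ball : ∀ a b, a < b → ∃ f : ℂ → ℂ, DifferentiableOn ℂ f (Metric.ball 0 ρ) ∧
    ∀ z ∈ annulus ρ, z * (h a z * h b z⁻¹) = f z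

theorem one_sub_mul_ne_zero {t : ℂ} {ρ : ℝ} (ht : ‖t‖ * ρ ^ 2 < 1) {a b : ℂ} (ha : ‖a‖ ≤ ρ)
    (hb : ‖b‖ ≤ ρ) : 1 - t * (a * b) ≠ 0 := by
  intro h
  have h1 : ‖t * (a * b)‖ = 1 := by rw [← sub_eq_zero.1 h, norm_one]
  rw [norm_mul, norm_mul] at h1
  have h2 : ‖a‖ * ‖b‖ ≤ ρ ^ 2 := by
    rw [sq]; exact mul_le_mul ha hb (norm_nonneg _) ((norm_nonneg _).trans ha)
  nlinarith [mul_le_mul_of_nonneg_left h2 (norm_nonneg t)]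

theorem pm₂_ne_zero {t : ℂ} {ρ : ℝ} (hρ : 1 < ρ) (ht : ‖t‖ * ρ ^ 2 < 1) {x y : ℂ}
    (hx : x ∈ annulus ρ) (hy : y ∈ annulus ρ) : pm₂ t x y ≠ 0 := by
  have hx' := (inv_mem_annulus hρ hx).2.le
  have hy' := (inv_mem_annulus hρ hy).2.le
  unfold pm₂
  exact mul_ne_zero (mul_ne_zero (mul_ne_zero (one_sub_mul_ne_zero ht hx.2.le hy.2.le)
    (one_sub_mul_ne_zero ht hx' hy')) (one_sub_mul_ne_zero ht hx' hy.2.le))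
    (one_sub_mul_ne_zero ht hx.2.le hy')

theorem letter_mem_annulus {n : ℕ} {ρ : ℝ} (hρ : 1 < ρ) {x : Fin n → ℂ}
    (hx : ∀ i, x i ∈ annulus ρ) (p : Fin n × Bool) : letter x p ∈ annulus ρ := by
  unfold letter
  split_ifs
  exacts [hx _, inv_mem_annulus hρ (hx _)]

theorem letter_injective {n : ℕ} {r : Fin n → ℝ} (hr : Function.Injective r)
    (hr0 : ∀ i, 0 < r i) (hr1 : ∀ i, r i < 1) {x : Fin n → ℂ} (hx : ∀ i, ‖x i‖ = r i) :
    Function.Injective (letter x) := by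
  rintro ⟨i, σ⟩ ⟨j, τ⟩ h
  have h' := congrArg norm h
  have hi := (one_lt_inv₀ (hr0 i)).2 (hr1 i)
  have hj := (one_lt_inv₀ (hr0 j)).2 (hr1 j)
  cases σ <;> cases τ <;>
    simp only [letter, if_true, Bool.false_eq_true, if_false, norm_inv, hx] at h'
  · rw [hr (inv_injective h')]
  · linarith [hr1 j]
  · linarith [hr1 i]
  · rw [hr h']

theorem admissible_removePair {t : ℂ} {ρ : ℝ} (hρ : 1 < ρ) (ht : ‖t‖ * ρ ^ 2 < 1) {N : ℕ}
    {h : Fin (N + 2) → ℂ → ℂ} (hh : Admissible ρ h) (b : Fin (N + 1)) (ε : ℤˣ) :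
    Admissible ρ (removePair t h b ((ε : ℤ) : ℂ)) := by
  have hε : ‖((ε : ℤ) : ℂ)‖ ≤ ρ := by
    rcases Int.units_eq_one_or ε with rfl | rfl <;> simp [hρ.le]
  have hεε : ((ε : ℤ) : ℂ) * ((ε : ℤ) : ℂ) = 1 := by
    rw [← Int.cast_mul, ← Units.val_mul, Int.units_mul_self]; simp
  set u : ℂ := ((ε : ℤ) : ℂ) with hu
  have hden : ∀ z : ℂ, ‖z‖ ≤ ρ → 1 - t * u * z ≠ 0 := fun z hz => by
    rw [mul_assoc]; exact one_sub_mul_ne_zero ht hε hz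
  have hdiff : DifferentiableOn ℂ (blaschke t u) (Metric.ball 0 ρ) := by
    unfold blaschke
    refine DifferentiableOn.div (by fun_prop) (by fun_prop) fun z hz => hden z ?_
    simpa using (Metric.mem_ball.1 hz).le
  have hsub : annulus ρ ⊆ Metric.ball 0 ρ := fun z hz => by simpa using hz.2
  refine ⟨fun c => ?_, fun c d hcd => ?_⟩
  · unfold removePair
    refine (hh.continuousOn _).mul ?_
    split_ifs
    · exact hdiff.continuousOn.mono hsub
    · exact continuousOn_const
  · have hlt : (b.succAbove c).succ < (b.succAbove d).succ :=
      Fin.succ_lt_succ_iff.2 (Fin.succAbove_lt_succAbove_iff.2 hcd)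
    obtain ⟨f, hf, hfz⟩ := hh.extends_to_ball _ _ hlt
    by_cases hd : b.succAbove d < b
    · have hc : b.succAbove c < b := (Fin.succAbove_lt_succAbove_iff.2 hcd).trans hd
      refine ⟨f, hf, fun z hz => ?_⟩
      have h0 := ne_zero_of_mem_annulus hρ hz
      -- both letters lie between the removed ones, and their Blaschke factors are inverse
      have hone : blaschke t u z * blaschke t u z⁻¹ = 1 := by
        have h1 := hden z hz.2.le
        have h2 := hden z⁻¹ (inv_mem_annulus hρ hz).2.le
        unfold blaschke
        rw [div_mul_div_comm, div_eq_one_iff_eq (mul_ne_zero h1 h2)]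
        linear_combination (z * z⁻¹ - t ^ 2 * z * z⁻¹) * hεε +
          (1 - t ^ 2) * mul_inv_cancel₀ h0
      simp only [removePair, hc, hd, if_true]
      rw [← hfz z hz]
      linear_combination (z * (h (b.succAbove c).succ z * h (b.succAbove d).succ z⁻¹)) * hone
    · by_cases hc : b.succAbove c < b
      · refine ⟨fun z => f z * blaschke t u z, hf.mul hdiff, fun z hz => ?_⟩
        simp only [removePair, hc, hd, if_true, if_false]
        rw [← hfz z hz]
        ring
      · refine ⟨f, hf, fun z hz => ?_⟩
        simp only [removePair, hc, hd, if_false]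
        rw [← hfz z hz]
        ring

theorem continuous_arrangementTerm {n N : ℕ} {t : ℂ} {ρ : ℝ} (hρ : 1 < ρ) (ht : ‖t‖ * ρ ^ 2 < 1)
    {r : Fin n → ℝ} (hr : Function.Injective r) (hr0 : ∀ i, ρ⁻¹ < r i) (hr1 : ∀ i, r i < 1)
    {h : Fin N → ℂ → ℂ} (hh : ∀ c, ContinuousOn (h c) (annulus ρ)) (e : Fin N ≃ Fin n × Bool) :
    Continuous fun θ => arrangementTerm t h e (torusMap 0 r θ) := by
  have hpos : ∀ i, 0 < r i := fun i => (inv_pos.2 (by linarith)).trans (hr0 i)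
  have hnorm := norm_torusMap_apply hpos
  have hx : ∀ θ i, torusMap 0 r θ i ∈ annulus ρ := fun θ i =>
    ⟨by rw [hnorm]; exact hr0 i, by rw [hnorm]; exact (hr1 i).trans hρ⟩
  have hx0 : ∀ θ i, torusMap 0 r θ i ≠ 0 := fun θ i => ne_zero_of_mem_annulus hρ (hx θ i)
  have hcx : ∀ i, Continuous fun θ => torusMap 0 r θ i := fun i =>
    (continuous_apply i).comp (continuous_torusMap r)
  have hci : ∀ i, Continuous fun θ => (torusMap 0 r θ i)⁻¹ := fun i =>
    (hcx i).inv₀ fun θ => hx0 θ i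
  have hl : ∀ p, Continuous fun θ => letter (torusMap 0 r θ) p := by
    intro p
    unfold letter
    split_ifs
    exacts [hcx _, hci _]
  have hinj := fun θ => letter_injective hr hpos hr1 (hnorm θ)
  unfold arrangementTerm
  refine (Continuous.mul ?_ ?_).mul (Continuous.mul ?_ ?_)
  · exact continuous_finsetProd _ fun c _ =>
      (hh c).comp_continuous (hl _) fun θ => letter_mem_annulus hρ (hx θ) _
  · refine continuous_finsetProd _ fun c _ => continuous_finsetProd _ fun d hd => ?_
    refine ((hl _).sub (continuous_const.mul (hl _))).div ((hl _).sub (hl _)) fun θ => ?_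
    exact sub_ne_zero.2 fun h => (mem_Ioi.1 hd).ne (e.injective (hinj θ h))
  · refine continuous_finsetProd _ fun i _ => ?_
    have h1 := hcx i
    have h2 := hci i
    refine Continuous.inv₀ (by fun_prop) fun θ => mul_ne_zero ?_ ?_
    · rw [sq]; exact one_sub_mul_ne_zero ht (hx θ i).2.le (hx θ i).2.le
    · rw [sq]
      have := (inv_mem_annulus hρ (hx θ i)).2.le
      exact one_sub_mul_ne_zero ht this this
  · refine continuous_finsetProd _ fun i _ => continuous_finsetProd _ fun j _ => ?_
    have h1 := hcx i
    have h2 := hci i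
    have h3 := hcx j
    have h4 := hci j
    refine Continuous.div ?_ ?_ fun θ => pm₂_ne_zero hρ ht (hx θ i) (hx θ j) <;>
    · unfold pm₂
      fun_prop

section FrontVariable

variable {n N : ℕ} {t : ℂ} {ρ : ℝ} {r : Fin (n + 1) → ℝ} {h : Fin (N + 2) → ℂ → ℂ}

/-- The front variable is integrated: if `x_i` itself stands in front the integral vanishes, and if
`x_i⁻¹` does, the residues at `±1` remain. -/
theorem circleAngleIntegral_arrangementTerm (hρ : 1 < ρ) (ht : ‖t‖ * ρ ^ 2 < 1)
    (hr : Function.Injective r) (hr0 : ∀ i, ρ⁻¹ < r i) (hr1 : ∀ i, r i < 1)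
    (hh : Admissible ρ h) (i : Fin (n + 1)) (σ : Bool) (b : Fin (N + 1))
    (e : Fin N ≃ Fin n × Bool) {y : Fin n → ℂ} (hy : ∀ j, ‖y j‖ = r (i.succAbove j)) :
    circleAngleIntegral (r i)
        (fun x => arrangementTerm t h (insertPair i σ b e) (i.insertNth x y)) =
      if σ then 0 else ∑ ε : ℤˣ, π / (1 - t) * (h 0 ((ε : ℤ) : ℂ) * h b.succ ((ε : ℤ) : ℂ)) *
        arrangementTerm t (removePair t h b ((ε : ℤ) : ℂ)) e y := by
  have hpos : ∀ i, 0 < r i := fun i => (inv_pos.2 (by linarith)).trans (hr0 i)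
  have hyA : ∀ j, y j ∈ annulus ρ := fun j =>
    ⟨by rw [hy]; exact hr0 _, by rw [hy]; exact (hr1 _).trans hρ⟩
  have hlA := letter_mem_annulus hρ hyA
  obtain ⟨f, hf, hfz⟩ := hh.extends_to_ball 0 b.succ (Fin.succ_pos b)
  set C := (∏ c, h (b.succAbove c).succ (letter y (e c))) * kern t (fun c => letter y (e c)) *
        weight t y with hC
  set B : ℂ → ℂ := fun u => ∏ c, if b.succAbove c < b then blaschke t u (letter y (e c)) else 1
    with hB
  set g : ℂ → ℂ := fun u => f u * ((1 - t * u ^ 2)⁻¹ * B u) * C with hg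
  have hgd : DifferentiableOn ℂ g (Metric.ball 0 ρ) := by
    have hball : ∀ u ∈ Metric.ball (0 : ℂ) ρ, ‖u‖ ≤ ρ := fun u hu => by
      simpa using (Metric.mem_ball.1 hu).le
    refine (hf.mul (DifferentiableOn.mul ?_ ?_)).mul_const C
    · refine DifferentiableOn.inv (by fun_prop) fun u hu => ?_
      rw [sq]; exact one_sub_mul_ne_zero ht (hball u hu) (hball u hu)
    · refine DifferentiableOn.fun_finsetProd fun c _ => ?_
      split_ifs
      · unfold blaschke
        refine DifferentiableOn.div (by fun_prop) (by fun_prop) fun u hu => ?_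
        rw [mul_assoc]; exact one_sub_mul_ne_zero ht (hball u hu) (hlA _).2.le
      · exact differentiableOn_const _
  have hterm : ∀ x : ℂ, ‖x‖ = r i →
      arrangementTerm t h (insertPair i σ b e) (i.insertNth x y) =
        g (if σ then x else x⁻¹) *
          ((if σ then x else x⁻¹) / ((if σ then x else x⁻¹) ^ 2 - 1)) := by
    intro x hx
    have hxA : x ∈ annulus ρ := ⟨by rw [hx]; exact hr0 i, by rw [hx]; exact (hr1 i).trans hρ⟩
    have huA : (if σ then x else x⁻¹) ∈ annulus ρ := by
      split_ifs
      exacts [hxA, inv_mem_annulus hρ hxA]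
    have hnu : ‖(if σ then x else x⁻¹)‖ = if σ then r i else (r i)⁻¹ := by
      cases σ <;> simp [hx]
    have hri := (one_lt_inv₀ (hpos i)).2 (hr1 i)
    -- distinct radii keep the denominators `u² - 1`, `u - y_j^{±1}` away from `0`
    have hu1 : ‖(if σ then x else x⁻¹)‖ ≠ 1 := by
      rw [hnu]; split_ifs
      exacts [(hr1 i).ne, hri.ne']
    have hne : ∀ j, ‖(if σ then x else x⁻¹)‖ ≠ ‖y j‖ ∧ ‖(if σ then x else x⁻¹)‖ ≠ ‖(y j)⁻¹‖ := by
      intro j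
      have h1 := (one_lt_inv₀ (hpos (i.succAbove j))).2 (hr1 (i.succAbove j))
      have h2 : r i ≠ r (i.succAbove j) := fun h => Fin.succAbove_ne i j (hr h).symm
      rw [hnu, norm_inv, hy]
      split_ifs
      · exact ⟨h2, ((hr1 i).trans h1).ne⟩
      · exact ⟨((hr1 _).trans hri).ne', fun h => h2 (inv_injective h)⟩
    have huinv := (inv_mem_annulus hρ huA).2.le
    rw [arrangementTerm_insertPair h i σ b e y rfl (ne_zero_of_mem_annulus hρ huA)
      (fun hsq => hu1 ?_) ?_ (fun j => ne_zero_of_mem_annulus hρ (hyA j))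
      (fun j => ⟨fun h => (hne j).1 (by rw [h]), fun h => (hne j).2 (by rw [h])⟩)
      (fun j => pm₂_ne_zero hρ ht huA (hyA j)) (fun p => ?_), hfz _ huA]
    · simp only [hg, hB, hC]
      ring
    · rw [sq]; exact one_sub_mul_ne_zero ht huinv huinv
    · have := congrArg norm hsq
      rw [norm_pow, norm_one] at this
      exact (pow_eq_one_iff_of_nonneg (norm_nonneg _) two_ne_zero).1 this
    · rw [mul_assoc]; exact one_sub_mul_ne_zero ht huA.2.le (hlA p).2.le
  rw [circleAngleIntegral_congr (hpos i) hterm]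
  cases σ
  · simp only [Bool.false_eq_true, if_false]
    rw [circleAngleIntegral_comp_inv (fun u => g u * (u / (u ^ 2 - 1))),
      circleAngleIntegral_outside hgd ((one_lt_inv₀ (hpos i)).2 (hr1 i))
        (inv_lt_of_inv_lt₀ (by linarith) (hr0 i))]
    have h1A : (1 : ℂ) ∈ annulus ρ := by
      simp only [annulus, Set.mem_ofPred_eq, norm_one]
      exact ⟨inv_lt_one_of_one_lt₀ hρ, hρ⟩
    have h2A : (-1 : ℂ) ∈ annulus ρ := by
      simp only [annulus, Set.mem_ofPred_eq, norm_neg, norm_one]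
      exact ⟨inv_lt_one_of_one_lt₀ hρ, hρ⟩
    have hrem : ∀ u : ℂ, arrangementTerm t (removePair t h b u) e y = B u * C := by
      intro u
      simp only [arrangementTerm, removePair, prod_mul_distrib, hB, hC]
      ring
    rw [show (univ : Finset ℤˣ) = {1, -1} from rfl, sum_pair (by decide)]
    simp only [hrem, hg, ← hfz _ h1A, ← hfz _ h2A]
    simp only [Units.val_one, Int.cast_one, Units.val_neg, Int.cast_neg, inv_one, inv_neg,
      one_pow, neg_one_sq, mul_one, one_mul]
    ring
  · simp only [if_true]
    exact circleAngleIntegral_inside hρ hgd (hpos i) (hr1 i)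

end FrontVariable

theorem torusAngleIntegral_sum {n : ℕ} {ι : Type*} (s : Finset ι) (r : Fin n → ℝ)
    {F : ι → (Fin n → ℂ) → ℂ} (hF : ∀ i ∈ s, Continuous fun θ => F i (torusMap 0 r θ)) :
    torusAngleIntegral r (fun x => ∑ i ∈ s, F i x) = ∑ i ∈ s, torusAngleIntegral r (F i) :=
  MeasureTheory.integral_finsetSum s fun i hi => (hF i hi).integrableOn_Icc

theorem torusAngleIntegral_const_mul {n : ℕ} (r : Fin n → ℝ) (a : ℂ) (F : (Fin n → ℂ) → ℂ) :
    torusAngleIntegral r (fun x => a * F x) = a * torusAngleIntegral r F :=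
  MeasureTheory.integral_const_mul a _

/-- The integral of the sum over all arrangements, over a torus with distinct radii slightly less
than `1`. -/
theorem torusAngleIntegral_sum_arrangementTerm {t : ℂ} {ρ : ℝ} (hρ : 1 < ρ)
    (ht : ‖t‖ * ρ ^ 2 < 1) (ht1 : ‖t‖ < 1) {n : ℕ} : ∀ {N : ℕ} (_ : N = 2 * n) {r : Fin n → ℝ}
    (_ : Function.Injective r) (_ : ∀ i, ρ⁻¹ < r i) (_ : ∀ i, r i < 1) {h : Fin N → ℂ → ℂ}
    (_ : Admissible ρ h),
    torusAngleIntegral r (fun x => ∑ e : Fin N ≃ Fin n × Bool, arrangementTerm t h e x) =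
      (π / (1 - t)) ^ n * n.factorial * signSum h := by
  induction n with
  | zero =>
    rintro N rfl r - - - h -
    have hE : ∀ e : Fin (2 * 0) ≃ Fin 0 × Bool, ∀ x, arrangementTerm t h e x = 1 := by
      intro e x
      simp [arrangementTerm, kern, weight]
    have hcard : Fintype.card (Fin (2 * 0) ≃ Fin 0 × Bool) = 1 := by
      rw [Fintype.card_equiv (Fintype.equivOfCardEq (by simp))]
      simp
    simp only [hE, sum_const, card_univ, hcard]
    simp [torusAngleIntegral, signSum, MeasureTheory.Measure.real]
  | succ n ih =>
    intro N hN r hr hr0 hr1 h hh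
    obtain ⟨N, rfl⟩ : ∃ M, N = M + 2 := ⟨2 * n, by omega⟩
    have hN' : N = 2 * n := by omega
    have hcont := fun e => continuous_arrangementTerm hρ ht hr hr0 hr1 hh.continuousOn e
    rw [torusAngleIntegral_sum _ _ fun e _ => hcont e, sum_insertPair hN']
    have hri : ∀ i : Fin (n + 1), Function.Injective fun j => r (i.succAbove j) := fun i =>
      hr.comp Fin.succAbove_right_injective
    have hrem := fun b ε => admissible_removePair hρ ht hh b ε
    have hfub : ∀ i σ b, ∀ e : Fin N ≃ Fin n × Bool,
        torusAngleIntegral r (arrangementTerm t h (insertPair i σ b e)) =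
        if σ then 0 else ∑ ε : ℤˣ, π / (1 - t) * (h 0 ((ε : ℤ) : ℂ) * h b.succ ((ε : ℤ) : ℂ)) *
          torusAngleIntegral (fun j => r (i.succAbove j))
            (arrangementTerm t (removePair t h b ((ε : ℤ) : ℂ)) e) := by
      intro i σ b e
      rw [torusAngleIntegral_succAbove r (hcont _) i, torusAngleIntegral_congr
        (fun j => (inv_pos.2 (by linarith)).trans (hr0 _)) fun y hy =>
          circleAngleIntegral_arrangementTerm hρ ht hr hr0 hr1 hh i σ b e hy]
      cases σ
      · simp only [Bool.false_eq_true, if_false]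
        rw [torusAngleIntegral_sum]
        · simp only [torusAngleIntegral_const_mul]
        · intro ε _
          exact continuous_const.mul (continuous_arrangementTerm hρ ht (hri i) (fun j => hr0 _)
            (fun j => hr1 _) (hrem b ε).continuousOn e)
      · simp [torusAngleIntegral]
    have hstep : ∀ i : Fin (n + 1), ∀ b, ∑ e : Fin N ≃ Fin n × Bool,
        ∑ ε : ℤˣ, π / (1 - t) * (h 0 ((ε : ℤ) : ℂ) * h b.succ ((ε : ℤ) : ℂ)) *
          torusAngleIntegral (fun j => r (i.succAbove j))
            (arrangementTerm t (removePair t h b ((ε : ℤ) : ℂ)) e) =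
        (π / (1 - t)) ^ (n + 1) * n.factorial * ∑ ε : ℤˣ,
          h 0 ((ε : ℤ) : ℂ) * h b.succ ((ε : ℤ) : ℂ) *
            signSum (removePair t h b ((ε : ℤ) : ℂ)) := by
      intro i b
      rw [sum_comm, mul_sum]
      refine sum_congr rfl fun ε _ => ?_
      rw [← mul_sum, ← torusAngleIntegral_sum _ _ fun e _ => continuous_arrangementTerm hρ ht
        (hri i) (fun j => hr0 _) (fun j => hr1 _) (hrem b ε).continuousOn e,
        ih hN' (hri i) (fun j => hr0 _) (fun j => hr1 _) (hrem b ε)]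
      ring
    simp only [hfub, Fintype.sum_bool, if_true, sum_const_zero, zero_add, Bool.false_eq_true,
      if_false, hstep]
    rw [← mul_sum, signSum_succ_succ ht1 (hN' ▸ even_two_mul n), sum_const, card_univ,
      Fintype.card_fin, Nat.factorial_succ, nsmul_eq_mul]
    push_cast
    ring

end HallLittlewood

namespace HallLittlewood

open Finset Koornwinder

/-! ### The Hall–Littlewood polynomial of the empty partition -/

/-- Lagrange interpolation of `∏ (X - t y_j) - ∏ (X - y_j)` at the nodes `y_j`, evaluated at
`0`. -/
theorem sum_prod_erase_ratio {N : ℕ} (t : ℂ) {y : Fin N → ℂ} (hy : Function.Injective y)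
    (hy0 : ∀ i, y i ≠ 0) :
    (1 - t) * ∑ i, ∏ j ∈ univ.erase i, (y i - t * y j) / (y i - y j) = 1 - t ^ N := by
  set p : Polynomial ℂ := ∏ j, (Polynomial.X - Polynomial.C (t * y j)) with hp
  set q : Polynomial ℂ := ∏ j, (Polynomial.X - Polynomial.C (y j)) with hq
  have hpm : p.Monic := Polynomial.monic_prod_of_monic _ _ fun j _ => Polynomial.monic_X_sub_C _
  have hqm : q.Monic := Polynomial.monic_prod_of_monic _ _ fun j _ => Polynomial.monic_X_sub_C _
  have hpd : p.degree = N := by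
    rw [hp, Polynomial.degree_prod]
    simp only [Polynomial.degree_X_sub_C, sum_const, card_univ, Fintype.card_fin, nsmul_eq_mul,
      mul_one]
  have hqd : q.degree = N := by simp [hq, Polynomial.degree_prod]
  have hdeg : (p - q).degree < (univ : Finset (Fin N)).card := by
    rw [card_univ, Fintype.card_fin, ← hpd]
    exact Polynomial.degree_sub_lt_left (hpd.trans hqd.symm) hpm.ne_zero
      (hpm.leadingCoeff.trans hqm.leadingCoeff.symm)
  have h := Lagrange.eq_interpolate (f := p - q) (s := univ) (v := y) hy.injOn hdeg
  have h0 := congrArg (Polynomial.eval 0) h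
  have hval : ∀ i, Polynomial.eval (y i) (p - q) =
      (1 - t) * y i * ∏ j ∈ univ.erase i, (y i - t * y j) := by
    intro i
    have hqi : Polynomial.eval (y i) q = 0 := by
      rw [hq, Polynomial.eval_prod]
      exact prod_eq_zero (mem_univ i) (by simp)
    rw [Polynomial.eval_sub, hqi, hp, Polynomial.eval_prod, ← mul_prod_erase _ _ (mem_univ i)]
    simp only [Polynomial.eval_sub, Polynomial.eval_X, Polynomial.eval_C]
    ring
  have hne : ∏ j, (-y j) ≠ 0 := prod_ne_zero_iff.2 fun j _ => neg_ne_zero.2 (hy0 j)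
  have hzero : Polynomial.eval 0 (p - q) = (t ^ N - 1) * ∏ j, (-y j) := by
    rw [Polynomial.eval_sub, hp, hq, Polynomial.eval_prod, Polynomial.eval_prod]
    simp only [Polynomial.eval_sub, Polynomial.eval_X, Polynomial.eval_C, zero_sub, ← mul_neg]
    rw [prod_mul_distrib, prod_const, card_univ, Fintype.card_fin]
    ring
  rw [hzero, Lagrange.interpolate_apply, Polynomial.eval_finsetSum] at h0
  have hterm : ∀ i, Polynomial.eval 0 (Polynomial.C (Polynomial.eval (y i) (p - q)) *
      Lagrange.basis univ y i) =
      -(∏ j, (-y j)) * ((1 - t) * ∏ j ∈ univ.erase i, (y i - t * y j) / (y i - y j)) := by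
    intro i
    rw [Polynomial.eval_mul, Polynomial.eval_C, hval, Lagrange.basis, Polynomial.eval_prod,
      ← mul_prod_erase _ _ (mem_univ i)]
    simp only [Lagrange.basisDivisor, Polynomial.eval_mul, Polynomial.eval_C, Polynomial.eval_sub,
      Polynomial.eval_X, zero_sub, prod_mul_distrib, div_eq_mul_inv]
    ring
  rw [sum_congr rfl fun i _ => hterm i, ← mul_sum, ← mul_sum] at h0
  refine mul_left_cancel₀ hne ?_
  linear_combination h0

/-- The symmetrization of `∏ (y_i - t y_j) / (y_i - y_j)` is constant. -/
theorem sum_perm_kern {t : ℂ} (ht : t ≠ 1) {N : ℕ} {y : Fin N → ℂ} (hy : Function.Injective y)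
    (hy0 : ∀ i, y i ≠ 0) :
    ∑ w : Equiv.Perm (Fin N), kern t (fun c => y (w c)) = tFactorial t N := by
  induction N with
  | zero => simp [kern, tFactorial]
  | succ N ih =>
    rw [← Equiv.Perm.decomposeFin.symm.sum_comp, Fintype.sum_prod_type]
    have hk : ∀ p : Fin (N + 1), ∀ e : Equiv.Perm (Fin N),
        kern t (fun c => y (Equiv.Perm.decomposeFin.symm (p, e) c)) =
          (∏ j ∈ univ.erase p, (y p - t * y j) / (y p - y j)) *
            kern t (fun c => y (Equiv.swap 0 p (e c).succ)) := by
      intro p e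
      rw [kern, prod_Ioi_succAbove 0]
      simp only [Fin.zero_succAbove, Fin.not_lt_zero, if_false,
        Equiv.Perm.decomposeFin_symm_apply_zero, Equiv.Perm.decomposeFin_symm_apply_succ]
      rw [Equiv.prod_comp e fun c : Fin N => (y p - t * y (Equiv.swap 0 p (Fin.succ c))) /
        (y p - y (Equiv.swap 0 p (Fin.succ c))), kern]
      congr 1
      -- at `j = p` the ratio would be the junk value `x / 0 = 0`, so it is replaced by `1`
      set G : Fin (N + 1) → ℂ := fun j => if j = p then 1 else (y p - t * y j) / (y p - y j)
        with hG
      have h1 : ∏ j ∈ univ.erase p, (y p - t * y j) / (y p - y j) = ∏ j, G j := by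
        rw [← prod_erase univ (f := G) (a := p) (by simp [hG])]
        refine prod_congr rfl fun j hj => ?_
        rw [hG]
        simp only [(mem_erase.1 hj).1, if_false]
      rw [h1, ← Equiv.prod_comp (Equiv.swap 0 p) G, Fin.prod_univ_succ]
      have h2 : ∀ c : Fin N, Equiv.swap 0 p c.succ ≠ p := fun c hc =>
        Fin.succ_ne_zero c ((Equiv.swap 0 p).injective (hc.trans (Equiv.swap_apply_left 0 p).symm))
      simp [hG, h2]
    simp only [hk]
    have hrest : ∀ p : Fin (N + 1), ∑ e : Equiv.Perm (Fin N),
        kern t (fun c => y (Equiv.swap 0 p (e c).succ)) = tFactorial t N := fun p =>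
      ih (y := fun c => y (Equiv.swap 0 p c.succ))
        (hy.comp ((Equiv.swap 0 p).injective.comp (Fin.succ_injective N))) fun i => hy0 _
    simp only [← mul_sum, hrest]
    have h1 : 1 - t ≠ 0 := sub_ne_zero.2 ht.symm
    rw [← sum_mul, tFactorial, tFactorial, prod_Icc_succ_top (by omega), tInt,
      ← sum_prod_erase_ratio t hy hy0]
    field_simp

theorem phi_eq {t : ℂ} (ht : t ≠ 1) (r : ℕ) : phi t r = tFactorial t r * (1 - t) ^ r := by
  have h1 : 1 - t ≠ 0 := sub_ne_zero.2 ht.symm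
  simp only [phi, tFactorial, tInt, prod_div_distrib, prod_const, Nat.card_Icc,
    Nat.add_sub_cancel]
  field_simp

theorem tFactorial_ne_zero {t : ℂ} (ht : ‖t‖ < 1) (r : ℕ) : tFactorial t r ≠ 0 := by
  refine prod_ne_zero_iff.2 fun j hj => div_ne_zero ?_ ?_
  · refine sub_ne_zero.2 fun h => ?_
    have h1 := congrArg norm h
    rw [norm_one, norm_pow] at h1
    exact (pow_lt_one₀ (norm_nonneg t) ht (by have := (mem_Icc.1 hj).1; omega)).ne' h1
  · exact sub_ne_zero.2 fun h => by rw [← h, norm_one] at ht; exact ht.false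

/-! ### The integrand of the theorem -/

theorem pmIndex_bijective (n : ℕ) : Function.Bijective (fun k : Fin (2 * n) =>
    if h : (k : ℕ) < n then ((⟨k, h⟩, true) : Fin n × Bool)
    else (⟨(k : ℕ) - n, by omega⟩, false)) := by
  rw [Fintype.bijective_iff_injective_and_card]
  refine ⟨fun k l h => ?_, by simp [mul_comm]⟩
  dsimp only at h
  split_ifs at h with h1 h2 h2 <;> simp only [Prod.mk.injEq, Fin.mk.injEq, and_true] at h
  · exact Fin.ext h
  · simp at h
  · simp at h
  · exact Fin.ext (by omega)

/-- The arrangement `x_1, …, x_n, x_1⁻¹, …, x_n⁻¹`. -/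
noncomputable def pmIndex (n : ℕ) : Fin (2 * n) ≃ Fin n × Bool :=
  Equiv.ofBijective _ (pmIndex_bijective n)

theorem pmVars_eq_letter {n : ℕ} (x : Fin n → ℂ) (k : Fin (2 * n)) :
    pmVars x k = letter x (pmIndex n k) := by
  simp only [pmVars, pmIndex, Equiv.ofBijective_apply]
  split_ifs <;> simp [letter]

/-- The integrand `R_lam(x^{±1}) W(x) ∏ (1 - α x_i^{±1})`. -/
noncomputable def integrand {n : ℕ} (t : ℂ) (lam : Fin (2 * n) → ℕ) (α : ℂ) (x : Fin n → ℂ) : ℂ :=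
  MvPolynomial.eval (pmVars x) (R t lam) * weight t x * ∏ i, pm α (x i)

theorem integrand_eq_sum_arrangementTerm {n : ℕ} (t : ℂ) (lam : Fin (2 * n) → ℕ) (α : ℂ)
    {x : Fin n → ℂ} (hx : Function.Injective (letter x)) :
    integrand t lam α x = ∑ e : Fin (2 * n) ≃ Fin n × Bool,
      arrangementTerm t (fun c z => z ^ lam c * (1 - α * z)) e x := by
  have hpm : pmVars x = fun k => letter x (pmIndex n k) := funext (pmVars_eq_letter x)
  rw [integrand, eval_R t lam (by rw [hpm]; exact hx.comp (pmIndex n).injective), sum_mul, sum_mul,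
    ← (Equiv.equivCongr (Equiv.refl (Fin (2 * n))) (pmIndex n)).sum_comp]
  refine sum_congr rfl fun w _ => ?_
  rw [arrangementTerm, prod_mul_distrib, prod_letter (fun z => 1 - α * z)]
  simp only [symmTerm, kern, hpm, pm, Equiv.equivCongr_apply_apply, Equiv.refl_symm,
    Equiv.refl_apply]
  ring

theorem admissible_pow {N : ℕ} {lam : Fin N → ℕ} (hlam : Antitone lam) (α : ℂ) {ρ : ℝ}
    (hρ : 1 < ρ) : Admissible ρ (fun c z => z ^ lam c * (1 - α * z)) := by
  refine ⟨fun c => by fun_prop, fun a b hab =>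
    ⟨fun z => z ^ (lam a - lam b) * (1 - α * z) * (z - α), by fun_prop, fun z hz => ?_⟩⟩
  have h0 := ne_zero_of_mem_annulus hρ hz
  obtain ⟨k, hk⟩ := Nat.exists_eq_add_of_le (hlam hab.le)
  rw [hk, Nat.add_sub_cancel_left, pow_add, inv_pow]
  field_simp

theorem differentiableOn_prod {E ι : Type*} [NormedAddCommGroup E] [NormedSpace ℂ E] {S : Set E}
    (s : Finset ι) {f : ι → E → ℂ} (hf : ∀ i ∈ s, DifferentiableOn ℂ (f i) S) :
    DifferentiableOn ℂ (fun x => ∏ i ∈ s, f i x) S := by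
  classical
  induction s using Finset.induction_on with
  | empty => simp
  | insert a s ha ih =>
    simp only [prod_insert ha]
    exact (hf a (mem_insert_self a s)).mul (ih fun i hi => hf i (mem_insert_of_mem hi))

section Differentiability

variable {n : ℕ} {t : ℂ} {ρ : ℝ}

theorem differentiableOn_coord (i : Fin n) :
    DifferentiableOn ℂ (fun x : Fin n → ℂ => x i) {x | ∀ i, x i ∈ annulus ρ} :=
  (differentiable_pi.1 differentiable_id i).differentiableOn

theorem differentiableOn_coord_inv (hρ : 1 < ρ) (i : Fin n) :
    DifferentiableOn ℂ (fun x : Fin n → ℂ => (x i)⁻¹) {x | ∀ i, x i ∈ annulus ρ} :=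
  (differentiableOn_coord i).inv fun _ hx => ne_zero_of_mem_annulus hρ (hx i)

theorem differentiableOn_weight (hρ : 1 < ρ) (ht : ‖t‖ * ρ ^ 2 < 1) :
    DifferentiableOn ℂ (weight (n := n) t) {x | ∀ i, x i ∈ annulus ρ} := by
  unfold weight
  refine DifferentiableOn.mul ?_ ?_
  · refine differentiableOn_prod _ fun i _ => ?_
    have h1 := differentiableOn_coord (ρ := ρ) i
    have h2 := differentiableOn_coord_inv hρ i
    refine DifferentiableOn.inv (by fun_prop) fun x hx => mul_ne_zero ?_ ?_
    · rw [sq]; exact one_sub_mul_ne_zero ht (hx i).2.le (hx i).2.le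
    · rw [sq]
      have := (inv_mem_annulus hρ (hx i)).2.le
      exact one_sub_mul_ne_zero ht this this
  · refine differentiableOn_prod _ fun i _ => differentiableOn_prod _ fun j _ => ?_
    have h1 := differentiableOn_coord (ρ := ρ) i
    have h2 := differentiableOn_coord_inv hρ i
    have h3 := differentiableOn_coord (ρ := ρ) j
    have h4 := differentiableOn_coord_inv hρ j
    simp only [div_eq_mul_inv]
    refine DifferentiableOn.mul ?_ (DifferentiableOn.inv ?_ ?_)
    · unfold pm₂
      fun_prop
    · unfold pm₂
      fun_prop
    · exact fun x hx => pm₂_ne_zero hρ ht (hx i) (hx j)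

theorem differentiableOn_integrand (hρ : 1 < ρ) (ht : ‖t‖ * ρ ^ 2 < 1)
    (lam : Fin (2 * n) → ℕ) (α : ℂ) :
    DifferentiableOn ℂ (integrand t lam α) {x | ∀ i, x i ∈ annulus ρ} := by
  unfold integrand
  refine (DifferentiableOn.mul ?_ (differentiableOn_weight hρ ht)).mul ?_
  · induction R t lam using MvPolynomial.induction_on with
    | C a => simp
    | add p q hp hq => simp only [map_add]; exact hp.add hq
    | mul_X p k hp =>
      simp only [map_mul, MvPolynomial.eval_X]
      refine hp.mul ?_
      unfold pmVars
      split_ifs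
      exacts [differentiableOn_coord _, differentiableOn_coord_inv hρ _]
  · refine differentiableOn_prod _ fun i _ => ?_
    have h1 := differentiableOn_coord (ρ := ρ) i
    have h2 := differentiableOn_coord_inv hρ i
    unfold pm
    fun_prop

end Differentiability

/-- Distinct radii between `ρ⁻¹` and `1`. -/
theorem exists_radii {ρ : ℝ} (hρ : 1 < ρ) (n : ℕ) :
    ∃ r : Fin n → ℝ, Function.Injective r ∧ (∀ i, ρ⁻¹ < r i) ∧ ∀ i, r i < 1 := by
  have h : 0 < 1 - ρ⁻¹ := sub_pos.2 (inv_lt_one_of_one_lt₀ hρ)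
  refine ⟨fun i => 1 - (1 - ρ⁻¹) / ((i : ℕ) + 2), fun i j hij => ?_, fun i => ?_, fun i => ?_⟩
  · have h1 : (1 - ρ⁻¹) / (((i : ℕ) : ℝ) + 2) = (1 - ρ⁻¹) / (((j : ℕ) : ℝ) + 2) := by
      simp only at hij; linarith
    rw [div_eq_div_iff (by positivity) (by positivity)] at h1
    have h2 := mul_left_cancel₀ h.ne' h1
    exact Fin.ext (by exact_mod_cast (add_right_cancel h2).symm)
  · have : (1 - ρ⁻¹) / (((i : ℕ) : ℝ) + 2) < 1 - ρ⁻¹ :=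
      div_lt_self h (by have : (0 : ℝ) ≤ ((i : ℕ) : ℝ) := Nat.cast_nonneg _; linarith)
    linarith
  · have : 0 < (1 - ρ⁻¹) / (((i : ℕ) : ℝ) + 2) := by positivity
    linarith

theorem exists_annulus_radius {t : ℂ} (ht : ‖t‖ < 1) : ∃ ρ : ℝ, 1 < ρ ∧ ‖t‖ * ρ ^ 2 < 1 := by
  have h : Filter.Tendsto (fun ρ : ℝ => ‖t‖ * ρ ^ 2) (nhdsWithin 1 (Set.Ioi 1))
      (nhds (‖t‖ * 1 ^ 2)) :=
    (Continuous.tendsto (by fun_prop) 1).mono_left nhdsWithin_le_nhds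
  obtain ⟨ρ, h1, h2⟩ := ((h.eventually_lt_const (by simpa using ht)).and
    self_mem_nhdsWithin).exists
  exact ⟨ρ, h2, h1⟩

/-- The integral of `R_lam(x^{±1}) W(x) ∏ (1 - α x_i^{±1})` over the unit torus. -/
theorem two_mul_torusAngleIntegral_integrand {n : ℕ} {t : ℂ} (ht : ‖t‖ < 1)
    {lam : Fin (2 * n) → ℕ} (hlam : Antitone lam) (α : ℂ) :
    2 * torusAngleIntegral 1 (integrand t lam α) = (π / (1 - t)) ^ n * n.factorial *
      (2 ^ (2 * n) * ((-α) ^ numOdd lam + (-α) ^ numEven lam)) := by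
  obtain ⟨ρ, hρ, htρ⟩ := exists_annulus_radius ht
  obtain ⟨r, hr, hr0, hr1⟩ := exists_radii hρ n
  have hpos : ∀ i, 0 < r i := fun i => (inv_pos.2 (by linarith)).trans (hr0 i)
  rw [torusAngleIntegral_eq_of_annulus hρ (differentiableOn_integrand hρ htρ lam α)
    (r := 1) (s := r)
    (fun i => ⟨inv_lt_one_of_one_lt₀ hρ, hρ⟩) (fun i => ⟨hr0 i, (hr1 i).trans hρ⟩),
    torusAngleIntegral_congr hpos fun x hx =>
      integrand_eq_sum_arrangementTerm t lam α (letter_injective hr hpos hr1 hx),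
    torusAngleIntegral_sum_arrangementTerm hρ htρ ht rfl hr hr0 hr1 (admissible_pow hlam α hρ),
    ← signSum_pow]
  ring

/-- For the empty partition and `α = 0` the integrand is a multiple of the weight. -/
theorem torusAngleIntegral_integrand_zero {n : ℕ} {t : ℂ} (ht : ‖t‖ < 1) :
    torusAngleIntegral 1 (integrand (n := n) t (fun _ => 0) 0) =
      tFactorial t (2 * n) * torusAngleIntegral 1 (weight (n := n) t) := by
  obtain ⟨ρ, hρ, htρ⟩ := exists_annulus_radius ht
  obtain ⟨r, hr, hr0, hr1⟩ := exists_radii hρ n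
  have hpos : ∀ i, 0 < r i := fun i => (inv_pos.2 (by linarith)).trans (hr0 i)
  have h1 : ∀ i : Fin n, ρ⁻¹ < (1 : Fin n → ℝ) i ∧ (1 : Fin n → ℝ) i < ρ :=
    fun i => ⟨inv_lt_one_of_one_lt₀ hρ, hρ⟩
  have h2 : ∀ i, ρ⁻¹ < r i ∧ r i < ρ := fun i => ⟨hr0 i, (hr1 i).trans hρ⟩
  have ht1 : t ≠ 1 := fun h => by rw [h, norm_one] at ht; exact ht.false
  rw [torusAngleIntegral_eq_of_annulus hρ (differentiableOn_integrand hρ htρ _ _) h1 h2,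
    torusAngleIntegral_eq_of_annulus hρ (differentiableOn_weight hρ htρ) h1 h2,
    ← torusAngleIntegral_const_mul]
  refine torusAngleIntegral_congr hpos fun x hx => ?_
  have hpm : pmVars x = fun k => letter x (pmIndex n k) := funext (pmVars_eq_letter x)
  have hxA : ∀ i, x i ∈ annulus ρ := fun i => ⟨by rw [hx]; exact hr0 i, by rw [hx]; exact (h2 i).2⟩
  have hinj : Function.Injective (pmVars x) := by
    rw [hpm]; exact (letter_injective hr hpos hr1 hx).comp (pmIndex n).injective
  have h0 : ∀ k, pmVars x k ≠ 0 := fun k => by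
    rw [hpm]; exact ne_zero_of_mem_annulus hρ (letter_mem_annulus hρ hxA _)
  rw [integrand, eval_R t _ hinj, ← sum_perm_kern ht1 hinj h0]
  simp [symmTerm, kern, pm]

/-! ### Passing to the Koornwinder density on the unit torus -/

/-- At points with some `x_i = ±1` the density takes the junk value `0 / 0 = 0`. -/
theorem density_eq_weight {n : ℕ} {s t : ℂ} (hs : s ^ 2 = t) {x : Fin n → ℂ}
    (hx : ∀ i, x i ^ 2 ≠ 1) :
    density 1 (-1) s (-s) t x = 1 / (2 ^ n * (n.factorial : ℂ)) * weight t x := by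
  rw [density, weight, mul_assoc]
  congr 2
  refine prod_congr rfl fun i _ => ?_
  have h1 : pm 1 (x i) * pm (-1) (x i) = (1 - x i ^ 2) * (1 - (x i)⁻¹ ^ 2) := by
    unfold pm; ring
  have h2 : pm s (x i) * pm (-s) (x i) = (1 - t * x i ^ 2) * (1 - t * (x i)⁻¹ ^ 2) := by
    rw [← hs]; unfold pm; ring
  have h3 : (1 - x i ^ 2) * (1 - (x i)⁻¹ ^ 2) ≠ 0 := by
    refine mul_ne_zero (sub_ne_zero.2 (hx i).symm) (sub_ne_zero.2 fun h => hx i ?_)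
    rw [inv_pow] at h
    exact inv_eq_one.1 h.symm
  rw [h1, mul_assoc, h2, div_mul_eq_div_div, div_self h3, one_div]

open MeasureTheory in
theorem ae_torusMap_sq_ne_one (n : ℕ) :
    ∀ᵐ θ : Fin n → ℝ, ∀ i, torusMap 0 1 θ i ^ 2 ≠ 1 := by
  have h : ∀ᵐ x : ℝ, Complex.exp (x * Complex.I) ^ 2 ≠ 1 := by
    have hc : (Set.range fun k : ℤ => (k : ℝ) * π).Countable := Set.countable_range _
    filter_upwards [hc.ae_notMem volume] with x hx hx1
    rw [← Complex.exp_nat_mul, Complex.exp_eq_one_iff] at hx1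
    obtain ⟨k, hk⟩ := hx1
    refine hx ⟨k, ?_⟩
    have h1 : ((2 : ℂ) * Complex.I) * ((k : ℂ) * π) = (2 * Complex.I) * x := by
      push_cast at hk
      linear_combination -hk
    have h2 := mul_left_cancel₀ (mul_ne_zero two_ne_zero Complex.I_ne_zero) h1
    exact_mod_cast h2
  have h' := Filter.eventually_all.2 fun i : Fin n =>
    (Measure.tendsto_eval_ae_ae (μ := fun _ : Fin n => (volume : Measure ℝ)) (i := i)).eventually h
  filter_upwards [h'] with θ hθ i
  simpa [torusMap] using hθ i

theorem torusMap_one_mem_annulus {n : ℕ} {ρ : ℝ} (hρ : 1 < ρ) (θ : Fin n → ℝ) (i : Fin n) :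
    torusMap 0 1 θ i ∈ annulus ρ := by
  have := norm_torusMap_apply (r := (1 : Fin n → ℝ)) (fun _ => one_pos) θ i
  simp only [annulus, Set.mem_ofPred_eq, this, Pi.one_apply]
  exact ⟨inv_lt_one_of_one_lt₀ hρ, hρ⟩

/-- A function that agrees on the unit torus, off the points with some `x_i = ±1`, with a constant
multiple of a function holomorphic near the torus. -/
theorem torusIntegrable_and_integralT_eq {n : ℕ} {ρ : ℝ} (hρ : 1 < ρ) {f F : (Fin n → ℂ) → ℂ}
    (hF : DifferentiableOn ℂ F {x | ∀ i, x i ∈ annulus ρ}) (κ : ℂ)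
    (hf : ∀ x : Fin n → ℂ, (∀ i, x i ^ 2 ≠ 1) → f x = κ * F x) :
    TorusIntegrable f 0 1 ∧
      integralT f = ((2 * π)⁻¹ : ℂ) ^ n * κ * torusAngleIntegral 1 F := by
  have hae : ∀ᵐ θ : Fin n → ℝ, κ * F (torusMap 0 1 θ) = f (torusMap 0 1 θ) := by
    filter_upwards [ae_torusMap_sq_ne_one n] with θ hθ
    exact (hf _ hθ).symm
  have hcont : Continuous fun θ : Fin n → ℝ => κ * F (torusMap 0 1 θ) :=
    continuous_const.mul (hF.continuousOn.comp_continuous (continuous_torusMap 1)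
      fun θ i => torusMap_one_mem_annulus hρ θ i)
  constructor
  · exact (hcont.integrableOn_Icc).congr (MeasureTheory.ae_restrict_of_ae hae)
  · rw [integralT, torusIntegral, torusAngleIntegral, ← MeasureTheory.integral_const_mul]
    refine MeasureTheory.integral_congr_ae (MeasureTheory.ae_restrict_of_ae ?_)
    filter_upwards [hae] with θ hθ
    have h1 : (∏ i, ((1 : Fin n → ℝ) i : ℂ) * Complex.exp (θ i * Complex.I) * Complex.I) *
        ∏ j, (2 * π * Complex.I * torusMap 0 1 θ j)⁻¹ = ((2 * π)⁻¹ : ℂ) ^ n := by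
      rw [← prod_mul_distrib, ← Fin.prod_const]
      refine prod_congr rfl fun i _ => ?_
      have := Complex.exp_ne_zero (θ i * Complex.I)
      have h2 : (π : ℂ) ≠ 0 := Complex.ofReal_ne_zero.2 Real.pi_ne_zero
      simp only [torusMap, Pi.zero_apply, Pi.one_apply, Complex.ofReal_one, zero_add, one_mul]
      field_simp
    rw [smul_eq_mul, ← mul_assoc, h1, ← hθ, mul_assoc]

end HallLittlewood

theorem theorem4p4 (n : ℕ) (hn : 1 ≤ n) (lam : Fin (2 * n) → ℕ) (hlam : Antitone lam)
    (t : ℂ) (ht : ‖t‖ < 1) (s : ℂ) (hs : s ^ 2 = t) (α : ℂ) :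
    TorusIntegrable (fun x : Fin n → ℂ => Koornwinder.density 1 (-1) s (-s) t x) 0 1 ∧
    TorusIntegrable (fun x : Fin n → ℂ => MvPolynomial.eval (Koornwinder.pmVars x) (HallLittlewood.P t lam) *
      Koornwinder.density 1 (-1) s (-s) t x * ∏ i, Koornwinder.pm α (x i)) 0 1 ∧
    Koornwinder.integralT (fun x : Fin n → ℂ => Koornwinder.density 1 (-1) s (-s) t x) ≠ 0 ∧
    1 / Koornwinder.integralT (fun x : Fin n → ℂ => Koornwinder.density 1 (-1) s (-s) t x) *
        Koornwinder.integralT (fun x : Fin n → ℂ => MvPolynomial.eval (Koornwinder.pmVars x) (HallLittlewood.P t lam) *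
          Koornwinder.density 1 (-1) s (-s) t x * ∏ i, Koornwinder.pm α (x i)) =
      HallLittlewood.phi t (2 * n) / (HallLittlewood.v t lam * (1 - t) ^ (2 * n)) *
        ((-α) ^ HallLittlewood.numOdd lam + (-α) ^ HallLittlewood.numEven lam) ∧
    HallLittlewood.phi t (2 * n) / (HallLittlewood.v t lam * (1 - t) ^ (2 * n)) *
        ((-α) ^ HallLittlewood.numOdd lam + (-α) ^ HallLittlewood.numEven lam) =
      HallLittlewood.tFactorial t (2 * n) / HallLittlewood.v t lam * ((-α) ^ HallLittlewood.numOdd lam + (-α) ^ HallLittlewood.numEven lam) := by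
  have ht1 : t ≠ 1 := fun h => by rw [h, norm_one] at ht; exact ht.false
  have h1t : 1 - t ≠ 0 := sub_ne_zero.2 ht1.symm
  obtain ⟨ρ, hρ, htρ⟩ := HallLittlewood.exists_annulus_radius ht
  set κ : ℂ := 1 / (2 ^ n * (n.factorial : ℂ)) with hκ
  have hκ0 : κ ≠ 0 := by
    have : (n.factorial : ℂ) ≠ 0 := Nat.cast_ne_zero.2 n.factorial_ne_zero
    exact one_div_ne_zero (mul_ne_zero (pow_ne_zero _ two_ne_zero) this)
  obtain ⟨hi1, he1⟩ := HallLittlewood.torusIntegrable_and_integralT_eq hρ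
    (HallLittlewood.differentiableOn_weight (n := n) hρ htρ) κ
    fun x hx => HallLittlewood.density_eq_weight hs hx
  obtain ⟨hi2, he2⟩ := HallLittlewood.torusIntegrable_and_integralT_eq hρ
    (HallLittlewood.differentiableOn_integrand (n := n) hρ htρ lam α)
    (κ * (HallLittlewood.v t lam)⁻¹)
    (f := fun x : Fin n → ℂ => MvPolynomial.eval (Koornwinder.pmVars x) (HallLittlewood.P t lam) *
      Koornwinder.density 1 (-1) s (-s) t x * ∏ i, Koornwinder.pm α (x i))
    fun x hx => by
      rw [HallLittlewood.density_eq_weight hs hx, HallLittlewood.P, map_mul,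
        MvPolynomial.eval_C, HallLittlewood.integrand]
      ring
  have hI := HallLittlewood.two_mul_torusAngleIntegral_integrand ht hlam α
  have hZ := HallLittlewood.two_mul_torusAngleIntegral_integrand ht
    (lam := fun _ : Fin (2 * n) => 0) antitone_const 0
  rw [HallLittlewood.torusAngleIntegral_integrand_zero ht] at hZ
  have hodd : HallLittlewood.numOdd (fun _ : Fin (2 * n) => 0) = 0 := by
    simp [HallLittlewood.numOdd]
  have heven : HallLittlewood.numEven (fun _ : Fin (2 * n) => 0) = 2 * n := by
    simp [HallLittlewood.numEven]
  rw [hodd, heven, neg_zero, pow_zero, zero_pow (by omega), add_zero, mul_one] at hZ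
  set A : ℂ := (Real.pi / (1 - t)) ^ n * n.factorial * 2 ^ (2 * n) with hA
  have hA0 : A ≠ 0 := by
    have h1 : (n.factorial : ℂ) ≠ 0 := Nat.cast_ne_zero.2 n.factorial_ne_zero
    have h2 : (Real.pi : ℂ) ≠ 0 := Complex.ofReal_ne_zero.2 Real.pi_ne_zero
    exact mul_ne_zero (mul_ne_zero (pow_ne_zero _ (div_ne_zero h2 h1t)) h1)
      (pow_ne_zero _ two_ne_zero)
  have hF0 := HallLittlewood.tFactorial_ne_zero ht (2 * n)
  set T₀ := HallLittlewood.torusAngleIntegral 1 (HallLittlewood.weight (n := n) t)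
  set T₁ := HallLittlewood.torusAngleIntegral 1 (HallLittlewood.integrand (n := n) t lam α)
  have hT₀ : T₀ ≠ 0 := fun h => hA0 (by rw [← hZ, h, mul_zero, mul_zero])
  have hc : ((2 * Real.pi)⁻¹ : ℂ) ^ n ≠ 0 := by
    have h2 : (Real.pi : ℂ) ≠ 0 := Complex.ofReal_ne_zero.2 Real.pi_ne_zero
    exact pow_ne_zero _ (inv_ne_zero (mul_ne_zero two_ne_zero h2))
  have hT₁ : T₁ = HallLittlewood.tFactorial t (2 * n) *
      ((-α) ^ HallLittlewood.numOdd lam + (-α) ^ HallLittlewood.numEven lam) * T₀ := by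
    refine mul_left_cancel₀ (two_ne_zero (α := ℂ)) ?_
    linear_combination hI -
      ((-α) ^ HallLittlewood.numOdd lam + (-α) ^ HallLittlewood.numEven lam) * hZ
  have hphi : HallLittlewood.phi t (2 * n) / (HallLittlewood.v t lam * (1 - t) ^ (2 * n)) =
      HallLittlewood.tFactorial t (2 * n) / HallLittlewood.v t lam := by
    rw [HallLittlewood.phi_eq ht1, mul_div_mul_right _ _ (pow_ne_zero _ h1t)]
  refine ⟨hi1, hi2, ?_, ?_, by rw [hphi]⟩
  · rw [he1]
    exact mul_ne_zero (mul_ne_zero hc hκ0) hT₀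
  · rw [hphi, he1, he2, hT₁, div_eq_mul_inv (HallLittlewood.tFactorial t (2 * n))]
    generalize (HallLittlewood.v t lam)⁻¹ = V
    field_simp
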